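/- **Setting.** Let $P=ax^4+bx^2+cx+d\in\mathbb{Q}[x]$ be irreducible with four real roots $x_1>x_2>x_3>x_4$ and Galois group $S_4$. Put $$\mathbb{D}=\prod_{j<k}(x_j-x_k),\qquad \Delta=\mathbb{D}^2,\qquad h_2=x_1x_2+x_3x_4,\quad h_3=x_1x_3+x_2x_4,\quad h_4=x_1x_4+x_2x_3 .$$ Let $F=\mathbb{Q}(x_1,i\mathbb{D})\subset\mathbb{C}$, $V=\mathbb{R}\otimes_{\mathbb{Q}}F$, let $\Lambda\subset V$ be the image of the ring of integers $\mathfrak{o}_F$, and let $X_r=V/\Lambda$. For $j=1,\dots,4$ let $\varphi_j:F\to\mathbb{C}$ be the embedding with $\varphi_j(x_1)=x_j$ and $\varphi_j(i\mathbb{D})=-(-1)^j i\mathbb{D}$, and let $z_j:V\to\mathbb{C}$ be its $\mathbb{R}$-linear extension. Degree-two cohomology classes of $X_r$ are identified with translation-invariant $2$-forms, that is, alternating forms on $V$; products of $1$-forms are exterior products; a class is rational if its form takes rational values on $\Lambda\times\Lambda$. With $\mu_j=\prod_{k\neq j}(x_j-x_k)$ and $m\in\mathbb{Z}$ set $$\omega=\frac{i\mathbb{D}}{\Delta}\left(\mu_1dz_1d\bar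 z_1-\mu_2dz_2d\bar z_2+\mu_3dz_3d\bar z_3-\mu_4dz_4d\bar z_4\right),\qquad A_1=B+\bar B,\qquad A_2=im\mathbb{D}\,(B-\bar B),$$ $$\begin{aligned}B={}&h_3(x_1-x_3)dz_1dz_3+h_3(x_2-x_4)d\bar z_2d\bar z_4+h_2(x_1-x_2)dz_1d\bar z_2\\&+h_2(x_3-x_4)dz_3d\bar z_4+h_4(x_1-x_4)dz_1d\bar z_4+h_4(x_3-x_2)dz_3d\bar z_2 .\end{aligned}$$ Let $$\alpha^*=\frac{1}{x_1-x_3}\begin{pmatrix}(x_2-x_3)\left(1-\frac{2h_4}{h_3}\right)&-(x_3-x_4)\left(1-\frac{2h_2}{h_3}\right)\\(x_1-x_2)\left(1-\frac{2h_2}{h_3}\right)&(x_1-x_4)\left(1-\frac{2h_4}{h_3}\right)\end{pmatrix},\qquad \tilde\alpha=\frac{x_1-x_3}{x_2-x_4}\,\operatorname{adj}\left(\overline{\alpha^*}\right).$$ **Theorem.** There is exactly one real-linear isomorphism $w=(w_1,w_2,w_3,w_4):V\to\mathbb{C}^4$ with $$\begin{pmatrix}z_1\\z_3\end{pmatrix}=\begin{pmatrix}w_1\\w_3\end{pmatrix}+\overline{\alpha^*}\begin{pmatrix}\bar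 w_2\\\bar w_4\end{pmatrix},\qquad\begin{pmatrix}z_2\\z_4\end{pmatrix}=\begin{pmatrix}w_2\\w_4\end{pmatrix}+\overline{\tilde\alpha}\begin{pmatrix}\bar w_1\\\bar w_3\end{pmatrix}.$$ Write $x_{jk}=x_j-x_k$ and $$p=x_{12}^2x_{23}^2x_{14}^2x_{34},\quad q=x_{12}^2x_{23}^2x_{14}x_{34}^2,\quad r=x_{12}x_{23}^2x_{14}^2x_{34}^2,\quad s=x_{12}^2x_{23}x_{14}^2x_{34}^2 .$$ Then $$\begin{aligned}\frac{h_3^2}{4}A_1={}&p\,dw_1d\bar w_2-q\,dw_2d\bar w_3+r\,dw_3d\bar w_4+s\,dw_4d\bar w_1\\&+p\,d\bar w_1dw_2-q\,d\bar w_2dw_3+r\,d\bar w_3dw_4+s\,d\bar w_4dw_1,\end{aligned}$$ $$\begin{aligned}\frac{h_3^2}{4i\mathbb{D}}A_2=m\,\bigl(&p\,dw_1d\bar w_2+q\,dw_2d\bar w_3+r\,dw_3d\bar w_4-s\,dw_4d\bar w_1\\&-p\,d\bar w_1dw_2-q\,d\bar w_2dw_3-r\,d\bar w_3dw_4+s\,d\bar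 w_4dw_1\bigr),\end{aligned}$$ $$\begin{aligned}\frac{\Delta h_3^2}{4i\mathbb{D}}\,\omega=-\bigl(&x_{12}^2x_{13}x_{23}x_{14}^2x_{34}\,dw_1d\bar w_1+x_{12}^2x_{23}^2x_{14}x_{24}x_{34}\,dw_2d\bar w_2\\&+x_{12}x_{13}x_{23}^2x_{14}x_{34}^2\,dw_3d\bar w_3+x_{12}x_{23}x_{14}^2x_{24}x_{34}^2\,dw_4d\bar w_4\bigr).\end{aligned}$$ Moreover $A_1$, $A_2$ and $\omega$ are rational classes. For the complex structure on $X_r$ with holomorphic coordinates $w_j$, the form $-\omega$ is a Kähler form (real, positive, of type $(1,1)$), $A_1$ and $A_2$ are of type $(1,1)$, and $X_r$ is an abelian variety (a complex torus that admits a polarization, i.e. a positive definite Riemann form integral on $\Lambda$). For the conjugate complex structure, with holomorphic coordinates $\bar w_j$, the form $\omega$ is Kähler, $A_1$ and $A_2$ are of type $(1,1)$, and the resulting complex torus $X'$ is an abelian variety. -/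

import Mathlib

open scoped TensorProduct ComplexConjugate NumberField

noncomputable section

/-! Invariant complex two-forms on a real torus `V / Λ`: alternating bilinear maps on `V`. -/

section Forms

variable {V : Type*} [AddCommGroup V] [Module ℝ V]

/-- Translation-invariant complex-valued two-forms on a real torus with universal cover `V`. -/
abbrev TwoForm (V : Type*) [AddCommGroup V] [Module ℝ V] : Type _ := V [⋀^Fin 2]→ₗ[ℝ] ℂ

/-- The exterior product of two one-forms: `(a ∧ b)(u, v) = a(u) b(v) - a(v) b(u)`. -/
def wedge (a b : V →ₗ[ℝ] ℂ) : TwoForm V where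
  toFun m := a (m 0) * b (m 1) - a (m 1) * b (m 0)
  map_update_add' m i x y := by
    fin_cases i <;> simp [Function.update] <;> ring
  map_update_smul' m i r x := by
    fin_cases i <;> simp [Function.update] <;> ring
  map_eq_zero_of_eq' m i j h hij := by
    fin_cases i <;> fin_cases j <;> simp_all

infixl:75 " ⋏ " => wedge

/-- The complex conjugate of a one-form. -/
def conjForm (a : V →ₗ[ℝ] ℂ) : V →ₗ[ℝ] ℂ := Complex.conjAe.toLinearMap ∘ₗ a

/-- The `j`-th coordinate differential `dw_j` of a linear coordinate system `w`. -/
def dw (w : V ≃ₗ[ℝ] (Fin 4 → ℂ)) (j : Fin 4) : V →ₗ[ℝ] ℂ :=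
  LinearMap.proj j ∘ₗ w.toLinearMap

/-- The conjugate coordinate differential `dw̄_j`. -/
def dwbar (w : V ≃ₗ[ℝ] (Fin 4 → ℂ)) (j : Fin 4) : V →ₗ[ℝ] ℂ := conjForm (dw w j)

/-- The complex structure on `V` for which `w` is a system of holomorphic coordinates. -/
def coordComplexStructure (w : V ≃ₗ[ℝ] (Fin 4 → ℂ)) : V →ₗ[ℝ] V :=
  w.symm.toLinearMap ∘ₗ (Complex.I • (LinearMap.id : (Fin 4 → ℂ) →ₗ[ℝ] (Fin 4 → ℂ))) ∘ₗ
    w.toLinearMap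

/-- A form is of type `(1,1)` for the complex structure `J` if it is a complex linear combination
of products of a `(1,0)`-form and a `(0,1)`-form. -/
def IsType11 (J : V →ₗ[ℝ] V) (φ : TwoForm V) : Prop :=
  φ ∈ Submodule.span ℂ {ψ : TwoForm V | ∃ a b : V →ₗ[ℝ] ℂ,
    (∀ u, a (J u) = Complex.I * a u) ∧ (∀ u, b (J u) = -(Complex.I * b u)) ∧ ψ = a ⋏ b}

/-- An invariant Kähler form: real, of type `(1,1)` and positive. (Invariant forms are closed.) -/
structure IsKahlerForm (J : V →ₗ[ℝ] V) (φ : TwoForm V) : Prop where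
  type11 : IsType11 J φ
  real : ∀ u v, (φ ![u, v]).im = 0
  pos : ∀ u, u ≠ 0 → 0 < (φ ![u, J u]).re

/-- The class of an invariant form in `H²(V / Λ, ℂ)` is rational, i.e. lies in `H²(V / Λ, ℚ)`:
its periods, which are its values on pairs of elements of `Λ = H₁(V / Λ, ℤ)`, are rational. -/
def IsRationalClass (Λ : AddSubgroup V) (φ : TwoForm V) : Prop :=
  ∀ u ∈ Λ, ∀ v ∈ Λ, ∃ q : ℚ, φ ![u, v] = (q : ℂ)

/-- `V / Λ` with the complex structure induced by `J` is an abelian variety: `Λ` is a lattice in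
`V`, `J` is a complex structure, and the complex torus `(V / Λ, J)` has a polarization, i.e. a
positive definite `J`-invariant alternating form that is integral on `Λ` (a Riemann form). -/
structure IsAbelianVariety (Λ : AddSubgroup V) (J : V →ₗ[ℝ] V) : Prop where
  lattice : ∃ b : Module.Basis (Fin (Module.finrank ℝ V)) ℝ V,
    AddSubgroup.closure (Set.range b) = Λ
  complex : ∀ u, J (J u) = -u
  polarization : ∃ E : V [⋀^Fin 2]→ₗ[ℝ] ℝ,
    (∀ u ∈ Λ, ∀ v ∈ Λ, ∃ n : ℤ, E ![u, v] = n) ∧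
    (∀ u v, E ![J u, J v] = E ![u, v]) ∧
    (∀ u, u ≠ 0 → 0 < E ![u, J u])

end Forms

/-- An irreducible polynomial `a x⁴ + b x² + c x + d` over `ℚ` with four real roots
`root 0 > root 1 > root 2 > root 3` and with Galois group the symmetric group on four letters.
(The roots `x₁, x₂, x₃, x₄` carry the indices `0, 1, 2, 3`.) -/
structure MumfordData where
  a : ℚ
  b : ℚ
  c : ℚ
  d : ℚ
  irreducible : Irreducible
    (Polynomial.C a * Polynomial.X ^ 4 + Polynomial.C b * Polynomial.X ^ 2
      + Polynomial.C c * Polynomial.X + Polynomial.C d)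
  root : Fin 4 → ℝ
  isRoot : ∀ j, a * root j ^ 4 + b * root j ^ 2 + c * root j + d = 0
  anti : StrictAnti root
  galois : Nonempty
    ((Polynomial.C a * Polynomial.X ^ 4 + Polynomial.C b * Polynomial.X ^ 2
      + Polynomial.C c * Polynomial.X + Polynomial.C d).Gal ≃* Equiv.Perm (Fin 4))

namespace MumfordData

variable (S : MumfordData)

/-- The polynomial. -/
def poly : Polynomial ℚ :=
  Polynomial.C S.a * Polynomial.X ^ 4 + Polynomial.C S.b * Polynomial.X ^ 2
    + Polynomial.C S.c * Polynomial.X + Polynomial.C S.d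

/-- The difference of the roots with indices `j` and `k`. -/
def δ (j k : Fin 4) : ℝ := S.root j - S.root k

/-- `𝔻`, the product of the differences `x_j - x_k` for `j < k`. -/
def D : ℝ := S.δ 0 1 * S.δ 0 2 * S.δ 0 3 * S.δ 1 2 * S.δ 1 3 * S.δ 2 3

/-- `Δ = 𝔻²`. -/
def Δ : ℝ := S.D ^ 2

/-- `h₂ = x₁x₂ + x₃x₄`. -/
def h₂ : ℝ := S.root 0 * S.root 1 + S.root 2 * S.root 3

/-- `h₃ = x₁x₃ + x₂x₄`. -/
def h₃ : ℝ := S.root 0 * S.root 2 + S.root 1 * S.root 3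

/-- `h₄ = x₁x₄ + x₂x₃`. -/
def h₄ : ℝ := S.root 0 * S.root 3 + S.root 1 * S.root 2

/-- The CM field `F = ℚ(x₁, i𝔻)` of degree eight. -/
def F : IntermediateField ℚ ℂ :=
  IntermediateField.adjoin ℚ {(S.root 0 : ℂ), Complex.I * (S.D : ℂ)}

/-- The generator `x₁` of `F`. -/
def x₁ : S.F := ⟨S.root 0, IntermediateField.subset_adjoin ℚ _ (by simp)⟩

/-- The generator `i𝔻` of `F`. -/
def iD : S.F := ⟨Complex.I * S.D, IntermediateField.subset_adjoin ℚ _ (by simp)⟩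

theorem poly_eval_root (j : Fin 4) : Polynomial.aeval (S.root j : ℂ) S.poly = 0 := by
  have h := S.isRoot j
  simp only [poly, map_add, map_mul, Polynomial.aeval_C, map_pow, Polynomial.aeval_X]
  simp only [eq_ratCast]
  exact_mod_cast h

/-- Every permutation of the roots is induced by an automorphism of the algebraic numbers. -/
theorem exists_aut (τ : Equiv.Perm (Fin 4)) :
    ∃ g : algebraicClosure ℚ ℂ ≃ₐ[ℚ] algebraicClosure ℚ ℂ,
      ∀ (j : Fin 4) (y : algebraicClosure ℚ ℂ), (y : ℂ) = S.root j →
        ((g y : algebraicClosure ℚ ℂ) : ℂ) = S.root (τ j) := by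
  classical
  let K := algebraicClosure ℚ ℂ
  have hp0 : S.poly ≠ 0 := S.irreducible.ne_zero
  have halg : ∀ j, (S.root j : ℂ) ∈ K := fun j =>
    mem_algebraicClosure_iff.2 ⟨S.poly, hp0, S.poly_eval_root j⟩
  let r : Fin 4 → S.poly.rootSet K := fun j => ⟨⟨S.root j, halg j⟩, by
    rw [Polynomial.mem_rootSet]
    refine ⟨hp0, ?_⟩
    apply Subtype.val_injective
    have h := S.poly_eval_root j
    exact (Polynomial.aeval_algHom_apply K.val (⟨S.root j, halg j⟩ : K) S.poly).symm.trans h⟩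
  have hr : Function.Injective r := by
    intro j k h
    have h1 : ((r j : K) : ℂ) = ((r k : K) : ℂ) := by rw [h]
    have h2 : (S.root j : ℂ) = S.root k := h1
    exact S.anti.injective (by exact_mod_cast h2)
  have hdeg : S.poly.natDegree ≤ 4 := by
    unfold poly; compute_degree
  have hcard : Fintype.card (S.poly.rootSet K) ≤ 4 := by
    rw [← Nat.card_eq_fintype_card, Nat.card_coe_set_eq, Polynomial.rootSet_def,
      Set.ncard_coe_finset]
    exact (Multiset.toFinset_card_le _).trans
      ((Polynomial.card_roots' _).trans (Polynomial.natDegree_map_le.trans hdeg))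
  have hrb : Function.Bijective r := by
    rw [Fintype.bijective_iff_injective_and_card]
    refine ⟨hr, ?_⟩
    have := Fintype.card_le_of_injective r hr
    simp only [Fintype.card_fin] at this ⊢
    omega
  let e : Fin 4 ≃ S.poly.rootSet K := Equiv.ofBijective r hrb
  have : IsAlgClosure ℚ K := algebraicClosure.isAlgClosure ℚ ℂ
  have : IsAlgClosed K := IsAlgClosure.isAlgClosed ℚ
  have : Normal ℚ K := IsAlgClosure.normal ℚ K
  have hs : Fact ((S.poly.map (algebraMap ℚ K)).Splits) := ⟨IsAlgClosed.splits _⟩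
  have hinj := Polynomial.Gal.galActionHom_injective S.poly K
  have hsurj : Function.Surjective (Polynomial.Gal.galActionHom S.poly K) := by
    obtain ⟨f⟩ := S.galois
    have f' : S.poly.Gal ≃ Equiv.Perm (Fin 4) := f.toEquiv
    have : Function.Injective
        (e.permCongr.symm ∘ Polynomial.Gal.galActionHom S.poly K ∘ f'.symm) :=
      e.permCongr.symm.injective.comp (hinj.comp f'.symm.injective)
    have h2 := Finite.surjective_of_injective this
    intro σ
    obtain ⟨t, ht⟩ := h2 (e.permCongr.symm σ)
    exact ⟨f'.symm t, e.permCongr.symm.injective ht⟩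
  obtain ⟨γ, hγ⟩ := hsurj (e.permCongr τ)
  obtain ⟨g, hg⟩ := Polynomial.Gal.restrict_surjective S.poly K γ
  refine ⟨g, fun j y hy => ?_⟩
  have hy' : y = (e j : K) := Subtype.val_injective hy
  have h1 := Polynomial.Gal.restrict_smul g (e j)
  rw [hg] at h1
  have h2 : γ • e j = e (τ j) := by
    have : Polynomial.Gal.galActionHom S.poly K γ (e j) = e (τ j) := by
      rw [hγ]; simp [Equiv.permCongr_apply]
    exact this
  rw [hy', ← h1, h2]
  rfl

theorem exists_embedding (j : Fin 4) : ∃ φ : S.F →ₐ[ℚ] ℂ,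
    φ S.x₁ = (S.root j : ℂ) ∧ φ S.iD = (-1 : ℂ) ^ (j : ℕ) * (Complex.I * S.D) := by
  obtain ⟨g, hg⟩ := S.exists_aut (Equiv.swap 0 j)
  let K := algebraicClosure ℚ ℂ
  have hp0 : S.poly ≠ 0 := S.irreducible.ne_zero
  have halg : ∀ j, (S.root j : ℂ) ∈ K := fun j =>
    mem_algebraicClosure_iff.2 ⟨S.poly, hp0, S.poly_eval_root j⟩
  have hI : Complex.I ∈ K := mem_algebraicClosure_iff.2
    ⟨Polynomial.X ^ 2 + 1, (Polynomial.monic_X_pow_add_C 1 two_ne_zero).ne_zero, by simp⟩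
  let y : Fin 4 → K := fun k => ⟨S.root k, halg k⟩
  let i : K := ⟨Complex.I, hI⟩
  let d : K := (y 0 - y 1) * (y 0 - y 2) * (y 0 - y 3) * (y 1 - y 2) * (y 1 - y 3) * (y 2 - y 3)
  have hd : (d : ℂ) = S.D := by simp [d, y, D, δ]
  have hF : S.F ≤ K := by
    rw [F, IntermediateField.adjoin_le_iff]
    rintro t (rfl | rfl)
    · exact halg 0
    · rw [← hd]; exact mul_mem hI d.2
  have hgy : ∀ k, ((g (y k) : K) : ℂ) = S.root (Equiv.swap 0 j k) := fun k => hg k (y k) rfl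
  have hgi : ((g i : K) : ℂ) ^ 2 = -1 := by
    have h : i ^ 2 = -1 := Subtype.val_injective (by simp [i])
    have h2 : (g i) ^ 2 = -1 := by rw [← map_pow, h]; simp
    simpa using congrArg (Subtype.val : K → ℂ) h2
  have hgd : ((g d : K) : ℂ) ^ 2 = (S.D : ℂ) ^ 2 := by
    simp only [d, map_mul, map_sub, MulMemClass.coe_mul, AddSubgroupClass.coe_sub, hgy]
    have a0 : S.D = (S.root 0 - S.root 1) * (S.root 0 - S.root 2) * (S.root 0 - S.root 3) *
      (S.root 1 - S.root 2) * (S.root 1 - S.root 3) * (S.root 2 - S.root 3) := rfl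
    rw [a0]
    push_cast
    fin_cases j
    · simp
    · have h1 : Equiv.swap (0 : Fin 4) 1 2 = 2 := by decide
      have h2 : Equiv.swap (0 : Fin 4) 1 3 = 3 := by decide
      simp [h1, h2]; ring
    · have h1 : Equiv.swap (0 : Fin 4) 2 1 = 1 := by decide
      have h2 : Equiv.swap (0 : Fin 4) 2 3 = 3 := by decide
      simp [h1, h2]; ring
    · have h1 : Equiv.swap (0 : Fin 4) 3 1 = 1 := by decide
      have h2 : Equiv.swap (0 : Fin 4) 3 2 = 2 := by decide
      simp [h1, h2]; ring
  let f : S.F →ₐ[ℚ] ℂ := (K.val.comp g.toAlgHom).comp (IntermediateField.inclusion hF)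
  have hf1 : f S.x₁ = S.root j := by
    have h := hgy 0
    rw [Equiv.swap_apply_left] at h
    exact h
  have hf2 : f S.iD = (g i : K) * (g d : K) := by
    have h : IntermediateField.inclusion hF S.iD = i * d :=
      Subtype.val_injective (by simp [iD, i, hd])
    change ((g (IntermediateField.inclusion hF S.iD) : K) : ℂ) = _
    rw [h, map_mul]; rfl
  have hsq : f S.iD ^ 2 = ((-1 : ℂ) ^ (j : ℕ) * (Complex.I * S.D)) ^ 2 := by
    rw [hf2, mul_pow, hgi, hgd, mul_pow, mul_pow, ← pow_mul, mul_comm (j : ℕ) 2, pow_mul]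
    simp
  rcases sq_eq_sq_iff_eq_or_eq_neg.1 hsq with h | h
  · exact ⟨f, hf1, h⟩
  · refine ⟨(Complex.conjAe.restrictScalars ℚ).toAlgHom.comp f, ?_, ?_⟩
    · change conj (f S.x₁) = _
      rw [hf1]; simp
    · change conj (f S.iD) = _
      rw [h]; simp

/-- The embedding of `F` with `x₁ ↦ x_j` and `i𝔻 ↦ -(-1)^j i𝔻` (for `j = 1, 2, 3, 4`; the sign is
`(-1)^j` for indices starting from `0`). The other four embeddings are the complex conjugates. -/
def embedding (j : Fin 4) : S.F →ₐ[ℚ] ℂ := (S.exists_embedding j).choose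

/-- The real vector space `V = ℝ ⊗ F`. -/
abbrev V : Type := ℝ ⊗[ℚ] S.F

/-- The lattice `Λ ⊂ V` of algebraic integers of `F`; the real eight-torus is `V / Λ`. -/
def Λ : AddSubgroup S.V :=
  ((Algebra.TensorProduct.includeRight : S.F →ₐ[ℚ] S.V).toRingHom.comp
    (algebraMap (𝓞 S.F) S.F)).toAddMonoidHom.range

/-- The `ℝ`-linear coordinate `z_j : V → ℂ` (also the one-form `dz_j`) induced by the `j`-th
embedding. -/
def z (j : Fin 4) : S.V →ₗ[ℝ] ℂ := LinearMap.liftBaseChange ℝ (S.embedding j).toLinearMap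

/-- The conjugate coordinate `z̄_j` (also the one-form `dz̄_j`). -/
def zbar (j : Fin 4) : S.V →ₗ[ℝ] ℂ := conjForm (S.z j)

/-- The class whose coefficient at `dz₁ ∧ dz₃` is `t h₃ (x₁ - x₃)`, whose other coefficients at the
pairs of embeddings with the same value at `i𝔻` (those of `z₁, z̄₂, z₃, z̄₄`) are obtained by
permuting the roots, and whose coefficients at the conjugate pairs are the same with `s` in place
of `t`. -/
def orbitForm (t s : ℂ) : TwoForm S.V :=
  t • ((S.h₃ * S.δ 0 2 : ℂ) • S.z 0 ⋏ S.z 2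
      + (S.h₃ * S.δ 1 3 : ℂ) • S.zbar 1 ⋏ S.zbar 3
      + (S.h₂ * S.δ 0 1 : ℂ) • S.z 0 ⋏ S.zbar 1
      + (S.h₂ * S.δ 2 3 : ℂ) • S.z 2 ⋏ S.zbar 3
      + (S.h₄ * S.δ 0 3 : ℂ) • S.z 0 ⋏ S.zbar 3
      + (S.h₄ * S.δ 2 1 : ℂ) • S.z 2 ⋏ S.zbar 1)
    + s • ((S.h₃ * S.δ 0 2 : ℂ) • S.zbar 0 ⋏ S.zbar 2
      + (S.h₃ * S.δ 1 3 : ℂ) • S.z 1 ⋏ S.z 3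
      + (S.h₂ * S.δ 0 1 : ℂ) • S.zbar 0 ⋏ S.z 1
      + (S.h₂ * S.δ 2 3 : ℂ) • S.zbar 2 ⋏ S.z 3
      + (S.h₄ * S.δ 0 3 : ℂ) • S.zbar 0 ⋏ S.z 3
      + (S.h₄ * S.δ 2 1 : ℂ) • S.zbar 2 ⋏ S.z 1)

/-- The Galois-covariant class `A₁ = h₃ (x₁ - x₃) dz₁ dz₃ + …`. -/
def A₁ : TwoForm S.V := S.orbitForm 1 1

/-- The Galois-covariant class `A₂ = i c 𝔻 h₃ (x₁ - x₃) dz₁ dz₃ + …`. -/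
def A₂ (c : ℤ) : TwoForm S.V :=
  S.orbitForm (Complex.I * c * S.D) (-(Complex.I * c * S.D))

/-- The conjugates of `μ₁ = (x₁ - x₂)(x₁ - x₃)(x₁ - x₄)`. -/
def μ (j : Fin 4) : ℝ := ∏ k ∈ Finset.univ.erase j, S.δ j k

/-- `ω = (i𝔻/Δ) (μ₁ dz₁ dz̄₁ - μ₂ dz₂ dz̄₂ + μ₃ dz₃ dz̄₃ - μ₄ dz₄ dz̄₄)`. -/
def ω : TwoForm S.V :=
  (Complex.I * S.D / S.Δ : ℂ) •
    ((S.μ 0 : ℂ) • S.z 0 ⋏ S.zbar 0 - (S.μ 1 : ℂ) • S.z 1 ⋏ S.zbar 1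
      + (S.μ 2 : ℂ) • S.z 2 ⋏ S.zbar 2 - (S.μ 3 : ℂ) • S.z 3 ⋏ S.zbar 3)

/-- The matrix `α*`. -/
def αStar : Matrix (Fin 2) (Fin 2) ℂ :=
  (1 / S.δ 0 2 : ℂ) •
    !![(S.δ 1 2 : ℂ) * (1 - 2 * S.h₄ / S.h₃), -(S.δ 2 3 : ℂ) * (1 - 2 * S.h₂ / S.h₃);
       (S.δ 0 1 : ℂ) * (1 - 2 * S.h₂ / S.h₃), (S.δ 0 3 : ℂ) * (1 - 2 * S.h₄ / S.h₃)]

/-- The matrix `α̃ = ((x₁ - x₃)/(x₂ - x₄))` times the adjugate of the conjugate of `α`. -/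
def αTilde (α : Matrix (Fin 2) (Fin 2) ℂ) : Matrix (Fin 2) (Fin 2) ℂ :=
  (S.δ 0 2 / S.δ 1 3 : ℂ) • (α.map conj).adjugate

/-- `w` is a coordinate system on `V` related to `z` by
`(z₁, z₃) = (w₁, w₃) + ᾱ (w̄₂, w̄₄)` and `(z₂, z₄) = (w₂, w₄) + conj(α̃) (w̄₁, w̄₃)`. -/
def IsAdapted (α : Matrix (Fin 2) (Fin 2) ℂ) (w : S.V ≃ₗ[ℝ] (Fin 4 → ℂ)) : Prop :=
  ∀ u : S.V,
    ![S.z 0 u, S.z 2 u] = ![w u 0, w u 2] + (α.map conj).mulVec ![conj (w u 1), conj (w u 3)] ∧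
    ![S.z 1 u, S.z 3 u] =
      ![w u 1, w u 3] + ((S.αTilde α).map conj).mulVec ![conj (w u 0), conj (w u 2)]

end MumfordData

end

/-! The theorem reduces to bilinear algebra over the roots once three facts are available.

**The sum of the roots.** The polynomial has no cubic term, so `x₁ + x₂ + x₃ + x₄ = 0`
(`MumfordData.root_three`). A transposition in the Galois group exchanges `h₃` and `h₂`, whose
difference is a product of differences of roots, so `h₃ ≠ 0` (`MumfordData.h₃_ne_zero`).

**The torus.** The square of `i𝔻` is rational, so every element of `F` is `f(x₁) + i𝔻 g(x₁)` with
`f, g ∈ ℚ[X]` (`MumfordData.exists_polynomials`), and its image under `φ_j` is `f(x_j) ± i𝔻 g(x_j)`.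
Hence `[F : ℚ] ≤ 8`, while interpolation at the four roots shows that `z : V → ℂ⁴` is onto;
therefore `z` is an isomorphism (`MumfordData.zMap_bijective`). In terms of `f` and `g`, the periods
of `A₁`, `A₂` and `ω` are rational combinations of `Δ` and of products of traces `∑_j F(x_j)` with
`F ∈ ℚ[X]`. Those are rational by the recursion for power sums, so the classes are rational
(`MumfordData.isRationalClass_A₁`, `isRationalClass_A₂`, `isRationalClass_ω`).

**The adapted coordinates.** The matrix `α*` is real, so `z₁, z̄₂, z₃, z̄₄` are combinations of
`w₁, w̄₂, w₃, w̄₄` alone. Eliminating `w̄₂, w̄₄` leaves `w₁, w₃` multiplied by the scalar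
`1 - k det α*`, `k = (x₁ - x₃)/(x₂ - x₄)`, because `α* adj α* = det α*`. The scalar equals
`-4 (x₁ - x₂)(x₂ - x₃)(x₁ - x₄)(x₃ - x₄) / h₃²` (`CoeffData.det_eq`) and is not zero, which gives
existence and uniqueness of `w`. The form `B` is a two-form in the first four functions; after the substitution
its coefficients at `dw₁ dw₃` and `dw̄₂ dw̄₄` vanish (`CoeffData.covariant_coeffs`), and the form
`ω` becomes diagonal (`CoeffData.hermitian_coeffs`). The coefficients of the diagonal form have
constant sign because the roots are ordered, which is the Kähler property of `-ω`; since its class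
is rational, a multiple of it is a Riemann form (`IsKahlerForm.isAbelianVariety`). Passing to the
conjugate complex structure changes the sign of the form and preserves the type `(1,1)`. -/

noncomputable section

/-! ### Coefficient identities for four numbers with vanishing sum -/

section Coefficients

variable {K : Type*} [Field K] {x₀ x₁ x₂ x₃ h₂ h₃ h₄ a b c d k : K}

/-- Four numbers `x₀, x₁, x₂, x₃` with sum zero, the invariants `h₂, h₃, h₄` of the three ways of
pairing them, the entries `a, b, c, d` of the matrix `α*`, and the factor `k` that relates `α̃` to
the adjugate of `α*`. -/
structure CoeffData (x₀ x₁ x₂ x₃ h₂ h₃ h₄ a b c d k : K) : Prop where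
  sum : x₃ = -(x₀ + x₁ + x₂)
  h₂_eq : h₂ = x₀ * x₁ + x₂ * x₃
  h₃_eq : h₃ = x₀ * x₂ + x₁ * x₃
  h₄_eq : h₄ = x₀ * x₃ + x₁ * x₂
  h₃_ne : h₃ ≠ 0
  ne₀₂ : x₀ - x₂ ≠ 0
  ne₁₃ : x₁ - x₃ ≠ 0
  a_eq : a = (x₁ - x₂) * (h₃ - 2 * h₄) / ((x₀ - x₂) * h₃)
  b_eq : b = -((x₂ - x₃) * (h₃ - 2 * h₂)) / ((x₀ - x₂) * h₃)
  c_eq : c = (x₀ - x₁) * (h₃ - 2 * h₂) / ((x₀ - x₂) * h₃)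
  d_eq : d = (x₀ - x₃) * (h₃ - 2 * h₄) / ((x₀ - x₂) * h₃)
  k_eq : k = (x₀ - x₂) / (x₁ - x₃)

namespace CoeffData

/-- The scalar `1 - k det α*` that obstructs the inversion of the transition from `w` to `z`. Outside
characteristic two it is nonzero as soon as the four numbers are distinct. -/
theorem det_eq (H : CoeffData x₀ x₁ x₂ x₃ h₂ h₃ h₄ a b c d k) :
    (1 - k * (a * d - b * c)) * h₃ ^ 2 =
      -(4 * ((x₀ - x₁) * (x₁ - x₂) * (x₀ - x₃) * (x₂ - x₃))) := by
  obtain ⟨hs, e₂, e₃, e₄, n₃, n02, n13, rfl, rfl, rfl, rfl, rfl⟩ := H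
  -- the denominators are kept as atoms while they are cleared
  generalize hU : x₀ - x₂ = U at *
  generalize hW : x₁ - x₃ = W at *
  field_simp
  subst hU hW e₂ e₃ e₄ hs
  ring

/-- The coefficients of the covariant two-form `∑ h_{jk} (x_j - x_k) y_j ∧ y_k` with respect to the
basis `(p₀, q₁, p₂, q₃)`, where `y₀ = p₀ + a q₁ + b q₃`, `y₁ = q₁ + k (d p₀ - b p₂)`,
`y₂ = p₂ + c q₁ + d q₃`, `y₃ = q₃ + k (a p₂ - c p₀)`. In the application
`y₀, y₁, y₂, y₃` are `z₁, z̄₂, z₃, z̄₄` and `p₀, q₁, p₂, q₃` are `w₁, w̄₂, w₃, w̄₄`, so the form is of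
type `(1,1)` because its coefficients at `p₀ ∧ p₂` and `q₁ ∧ q₃` vanish. -/
theorem covariant_coeffs (H : CoeffData x₀ x₁ x₂ x₃ h₂ h₃ h₄ a b c d k) :
    ((h₂ * (x₀ - x₁)) * (1 - a * k * d) + (h₃ * (x₀ - x₂)) * c + (h₄ * (x₀ - x₃)) * (a * k * c)
      + (h₄ * (x₁ - x₂)) * (k * d * c) + (h₃ * (x₁ - x₃)) * (k * c)
      + (h₂ * (x₂ - x₃)) * (k * c ^ 2)) * h₃ ^ 2
        = 4 * ((x₀ - x₁) ^ 2 * (x₁ - x₂) ^ 2 * (x₀ - x₃) ^ 2 * (x₂ - x₃)) ∧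
    -((h₂ * (x₀ - x₁)) * (k * b)) + (h₃ * (x₀ - x₂)) + (h₄ * (x₀ - x₃)) * (k * a)
      + (h₄ * (x₁ - x₂)) * (k * d) + (h₃ * (x₁ - x₃)) * (k ^ 2 * (a * d - b * c))
      + (h₂ * (x₂ - x₃)) * (k * c) = 0 ∧
    (-((h₂ * (x₀ - x₁)) * (b * k * d)) + (h₃ * (x₀ - x₂)) * d + (h₄ * (x₀ - x₃)) * (1 + b * k * c)
      + (h₄ * (x₁ - x₂)) * (k * d ^ 2) + (h₃ * (x₁ - x₃)) * (k * d)
      + (h₂ * (x₂ - x₃)) * (k * c * d)) * h₃ ^ 2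
        = -(4 * ((x₀ - x₁) ^ 2 * (x₁ - x₂) * (x₀ - x₃) ^ 2 * (x₂ - x₃) ^ 2)) ∧
    (-((h₂ * (x₀ - x₁)) * (k * a * b)) + (h₃ * (x₀ - x₂)) * a + (h₄ * (x₀ - x₃)) * (k * a ^ 2)
      + (h₄ * (x₁ - x₂)) * (1 + k * b * c) + (h₃ * (x₁ - x₃)) * (k * a)
      + (h₂ * (x₂ - x₃)) * (k * a * c)) * h₃ ^ 2
        = -(4 * ((x₀ - x₁) ^ 2 * (x₁ - x₂) ^ 2 * (x₀ - x₃) * (x₂ - x₃) ^ 2)) ∧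
    -((h₂ * (x₀ - x₁)) * b) + (h₃ * (x₀ - x₂)) * (a * d - b * c) + (h₄ * (x₀ - x₃)) * a
      + (h₄ * (x₁ - x₂)) * d + (h₃ * (x₁ - x₃)) + (h₂ * (x₂ - x₃)) * c = 0 ∧
    ((h₂ * (x₀ - x₁)) * (k * b ^ 2) - (h₃ * (x₀ - x₂)) * b - (h₄ * (x₀ - x₃)) * (k * a * b)
      - (h₄ * (x₁ - x₂)) * (k * b * d) - (h₃ * (x₁ - x₃)) * (k * b)
      + (h₂ * (x₂ - x₃)) * (1 - k * a * d)) * h₃ ^ 2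
        = 4 * ((x₀ - x₁) * (x₁ - x₂) ^ 2 * (x₀ - x₃) ^ 2 * (x₂ - x₃) ^ 2) := by
  obtain ⟨hs, e₂, e₃, e₄, n₃, n02, n13, rfl, rfl, rfl, rfl, rfl⟩ := H
  generalize hU : x₀ - x₂ = U at *
  generalize hW : x₁ - x₃ = W at *
  refine ⟨?_, ?_, ?_, ?_, ?_, ?_⟩ <;>
    (field_simp; subst hU hW e₂ e₃ e₄ hs; ring)

/-- The coefficients of the Hermitian form `∑ μ_j y_j ȳ_j`, `μ_j = ∏_{k ≠ j} (x_j - x_k)`, in the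
same basis: the form becomes diagonal. Up to a factor, `ω` is the antisymmetrization of this form,
the alternating signs in `ω` being those of `dz_j dz̄_j = ± dy_j dȳ_j`. -/
theorem hermitian_coeffs (H : CoeffData x₀ x₁ x₂ x₃ h₂ h₃ h₄ a b c d k) {μ₀ μ₁ μ₂ μ₃ : K}
    (hμ₀ : μ₀ = (x₀ - x₁) * (x₀ - x₂) * (x₀ - x₃)) (hμ₁ : μ₁ = (x₁ - x₀) * (x₁ - x₂) * (x₁ - x₃))
    (hμ₂ : μ₂ = (x₂ - x₀) * (x₂ - x₁) * (x₂ - x₃))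
    (hμ₃ : μ₃ = (x₃ - x₀) * (x₃ - x₁) * (x₃ - x₂)) :
    ((μ₀ + μ₁ * (k * d) ^ 2 + μ₃ * (k * c) ^ 2) * h₃ ^ 2
      = -(4 * ((x₀ - x₁) ^ 2 * (x₀ - x₂) * (x₁ - x₂) * (x₀ - x₃) ^ 2 * (x₂ - x₃))) ∧
    (μ₀ * a ^ 2 + μ₁ + μ₂ * c ^ 2) * h₃ ^ 2
      = 4 * ((x₀ - x₁) ^ 2 * (x₁ - x₂) ^ 2 * (x₀ - x₃) * (x₁ - x₃) * (x₂ - x₃)) ∧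
    (μ₁ * (k * b) ^ 2 + μ₂ + μ₃ * (k * a) ^ 2) * h₃ ^ 2
      = -(4 * ((x₀ - x₁) * (x₀ - x₂) * (x₁ - x₂) ^ 2 * (x₀ - x₃) * (x₂ - x₃) ^ 2)) ∧
    (μ₀ * b ^ 2 + μ₂ * d ^ 2 + μ₃) * h₃ ^ 2
      = 4 * ((x₀ - x₁) * (x₁ - x₂) * (x₀ - x₃) ^ 2 * (x₁ - x₃) * (x₂ - x₃) ^ 2)) ∧
    μ₀ * a + μ₁ * (k * d) = 0 ∧ μ₁ * (k ^ 2 * b * d) + μ₃ * (k ^ 2 * a * c) = 0 ∧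
    μ₀ * b - μ₃ * (k * c) = 0 ∧ μ₂ * c - μ₁ * (k * b) = 0 ∧
    μ₀ * (a * b) + μ₂ * (c * d) = 0 ∧ μ₂ * d + μ₃ * (k * a) = 0 := by
  obtain ⟨hs, e₂, e₃, e₄, n₃, n02, n13, rfl, rfl, rfl, rfl, rfl⟩ := H
  -- `x₂ - x₀` and `x₃ - x₁` are written through the two denominators
  rw [← neg_sub x₀ x₂] at hμ₂
  rw [← neg_sub x₁ x₃] at hμ₃
  generalize hU : x₀ - x₂ = U at *
  generalize hW : x₁ - x₃ = W at *
  subst hμ₀ hμ₁ hμ₂ hμ₃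
  refine ⟨⟨?_, ?_, ?_, ?_⟩, ?_, ?_, ?_, ?_, ?_, ?_⟩ <;>
    (field_simp; subst hU hW e₂ e₃ e₄ hs; ring)

end CoeffData

end Coefficients

/-! ### Kähler forms and polarizations in linear coordinates -/

section Forms

theorem update_pair_zero {U : Type*} (x y v : U) : Function.update ![x, v] 0 y = ![y, v] := by
  ext i
  fin_cases i <;> rfl

theorem update_pair_one {U : Type*} (x y v : U) : Function.update ![v, x] 1 y = ![v, y] := by
  ext i
  fin_cases i <;> rfl

variable {V : Type*} [AddCommGroup V] [Module ℝ V]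

section Bilinear

variable {M : Type*} [AddCommGroup M] [Module ℝ M] (φ : V [⋀^Fin 2]→ₗ[ℝ] M) (x y v : V)

theorem alternating_add_left : φ ![x + y, v] = φ ![x, v] + φ ![y, v] := by
  simpa only [update_pair_zero] using φ.map_update_add ![x, v] 0 x y

theorem alternating_add_right : φ ![v, x + y] = φ ![v, x] + φ ![v, y] := by
  simpa only [update_pair_one] using φ.map_update_add ![v, x] 1 x y

theorem alternating_neg_left : φ ![-x, v] = -φ ![x, v] := by
  simpa only [update_pair_zero] using φ.map_update_neg ![x, v] 0 x

theorem alternating_neg_right : φ ![v, -x] = -φ ![v, x] := by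
  simpa only [update_pair_one] using φ.map_update_neg ![v, x] 1 x

end Bilinear

theorem wedge_apply (a b : V →ₗ[ℝ] ℂ) (m : Fin 2 → V) :
    (a ⋏ b) m = a (m 0) * b (m 1) - a (m 1) * b (m 0) := rfl

theorem wedge_swap (a b : V →ₗ[ℝ] ℂ) : a ⋏ b = -(b ⋏ a) := by
  ext m
  simp only [AlternatingMap.neg_apply, wedge_apply]
  ring

theorem conjForm_apply (a : V →ₗ[ℝ] ℂ) (u : V) : conjForm a u = conj (a u) := rfl

theorem dw_apply (w : V ≃ₗ[ℝ] (Fin 4 → ℂ)) (j : Fin 4) (u : V) : dw w j u = w u j := rfl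

theorem dwbar_apply (w : V ≃ₗ[ℝ] (Fin 4 → ℂ)) (j : Fin 4) (u : V) :
    dwbar w j u = conj (w u j) := rfl

theorem coord_coordComplexStructure (w : V ≃ₗ[ℝ] (Fin 4 → ℂ)) (u : V) (j : Fin 4) :
    w (coordComplexStructure w u) j = Complex.I * w u j := by
  simp [coordComplexStructure]

theorem coordComplexStructure_sq (w : V ≃ₗ[ℝ] (Fin 4 → ℂ)) (u : V) :
    coordComplexStructure w (coordComplexStructure w u) = -u := by
  apply w.injective
  ext j
  rw [coord_coordComplexStructure, coord_coordComplexStructure, ← mul_assoc, Complex.I_mul_I,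
    map_neg, Pi.neg_apply, neg_one_mul]

namespace IsType11

variable {J : V →ₗ[ℝ] V} {φ ψ : TwoForm V}

theorem add (hφ : IsType11 J φ) (hψ : IsType11 J ψ) : IsType11 J (φ + ψ) :=
  Submodule.add_mem _ hφ hψ

theorem sub (hφ : IsType11 J φ) (hψ : IsType11 J ψ) : IsType11 J (φ - ψ) :=
  Submodule.sub_mem _ hφ hψ

theorem neg (hφ : IsType11 J φ) : IsType11 J (-φ) := Submodule.neg_mem _ hφ

theorem smul (t : ℂ) (hφ : IsType11 J φ) : IsType11 J (t • φ) := Submodule.smul_mem _ t hφ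

theorem real_smul (t : ℝ) (hφ : IsType11 J φ) : IsType11 J (t • φ) := by
  have h : t • φ = (t : ℂ) • φ := by ext m; simp
  rw [h]
  exact hφ.smul _

theorem of_smul {t : ℂ} (ht : t ≠ 0) (h : IsType11 J (t • φ)) : IsType11 J φ :=
  (Submodule.smul_mem_iff _ ht).1 h

/-- The type `(1,1)` is insensitive to conjugation of the complex structure. -/
theorem neg_structure (h : IsType11 J φ) : IsType11 (-J) φ := by
  refine Submodule.span_le.2 ?_ h
  rintro _ ⟨a, b, ha, hb, rfl⟩
  rw [wedge_swap]
  refine Submodule.neg_mem _ (Submodule.subset_span ⟨b, a, fun u => ?_, fun u => ?_, rfl⟩)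
  · simp [hb]
  · simp [ha]

theorem map_map (h : IsType11 J φ) (u v : V) : φ ![J u, J v] = φ ![u, v] := by
  induction h using Submodule.span_induction with
  | mem _ h =>
    obtain ⟨a, b, ha, hb, rfl⟩ := h
    simp only [wedge_apply, Matrix.cons_val_zero, Matrix.cons_val_one, ha, hb]
    linear_combination (a v * b u - a u * b v) * Complex.I_mul_I
  | zero => simp
  | add _ _ _ _ h₁ h₂ => simp [h₁, h₂]
  | smul t _ _ h => simp [h]

end IsType11

theorem isType11_dw_dwbar (w : V ≃ₗ[ℝ] (Fin 4 → ℂ)) (j k : Fin 4) :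
    IsType11 (coordComplexStructure w) (dw w j ⋏ dwbar w k) := by
  refine Submodule.subset_span ⟨_, _, fun u => ?_, fun u => ?_, rfl⟩
  · simp only [dw_apply, coord_coordComplexStructure]
  · simp [dwbar_apply, coord_coordComplexStructure]

theorem isType11_dwbar_dw (w : V ≃ₗ[ℝ] (Fin 4 → ℂ)) (j k : Fin 4) :
    IsType11 (coordComplexStructure w) (dwbar w j ⋏ dw w k) := by
  rw [wedge_swap]
  exact (isType11_dw_dwbar w k j).neg

theorem IsKahlerForm.neg_structure {J : V →ₗ[ℝ] V} {φ : TwoForm V} (h : IsKahlerForm J φ) :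
    IsKahlerForm (-J) (-φ) where
  type11 := h.type11.neg_structure.neg
  real u v := by simp [h.real]
  pos u hu := by
    simpa [alternating_neg_right] using h.pos u hu

theorem isKahlerForm_of_diagonal (w : V ≃ₗ[ℝ] (Fin 4 → ℂ)) (κ : Fin 4 → ℝ) (hκ : ∀ j, 0 < κ j)
    {φ : TwoForm V} (hφ : φ = Complex.I • ∑ j, κ j • dw w j ⋏ dwbar w j) :
    IsKahlerForm (coordComplexStructure w) φ := by
  have happ : ∀ u v, φ ![u, v] =
      Complex.I * ∑ j, (κ j : ℂ) * (w u j * conj (w v j) - w v j * conj (w u j)) := by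
    intro u v
    simp only [hφ, Fin.sum_univ_four, AlternatingMap.smul_apply, AlternatingMap.add_apply,
      wedge_apply, dw_apply, dwbar_apply, Matrix.cons_val_zero, Matrix.cons_val_one, smul_eq_mul,
      Complex.real_smul]
  refine ⟨?_, fun u v => ?_, fun u hu => ?_⟩
  · rw [hφ]
    refine IsType11.smul _ (Submodule.sum_mem _ fun j _ => ?_)
    exact (isType11_dw_dwbar w j j).real_smul _
  · rw [happ]
    simp only [Complex.I_mul_im, Complex.re_sum, Complex.re_ofReal_mul]
    refine Finset.sum_eq_zero fun j _ => ?_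
    simp only [Complex.sub_re, Complex.mul_re, Complex.conj_re, Complex.conj_im]
    ring
  · have h1 : (φ ![u, coordComplexStructure w u]).re = ∑ j, 2 * κ j * Complex.normSq (w u j) := by
      rw [happ]
      simp only [Complex.I_mul_re, Complex.im_sum, Complex.im_ofReal_mul]
      rw [← Finset.sum_neg_distrib]
      refine Finset.sum_congr rfl fun j _ => ?_
      simp only [coord_coordComplexStructure, Complex.sub_im, Complex.mul_im, Complex.mul_re,
        Complex.conj_re, Complex.conj_im, Complex.I_re, Complex.I_im, Complex.normSq_apply]
      ring
    rw [h1]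
    obtain ⟨j, hj⟩ : ∃ j, w u j ≠ 0 := by
      by_contra! h
      exact hu (w.injective (by ext j; simp [h j]))
    refine Finset.sum_pos' (fun i _ => ?_) ⟨j, Finset.mem_univ j, ?_⟩
    · exact mul_nonneg (by linarith [hκ i]) (Complex.normSq_nonneg _)
    · exact mul_pos (by linarith [hκ j]) (Complex.normSq_pos.2 hj)

/-- A rational class becomes integral on a finitely generated group after multiplication by a
common denominator of its periods. -/
theorem IsRationalClass.exists_integral {ι : Type*} [Finite ι] {φ : TwoForm V} {b : ι → V}
    (h : IsRationalClass (AddSubgroup.closure (Set.range b)) φ) :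
    ∃ N : ℕ, 0 < N ∧ ∀ u ∈ AddSubgroup.closure (Set.range b),
      ∀ v ∈ AddSubgroup.closure (Set.range b), ∃ n : ℤ, N * φ ![u, v] = n := by
  have := Fintype.ofFinite ι
  have hb : ∀ i, b i ∈ AddSubgroup.closure (Set.range b) := fun i =>
    AddSubgroup.subset_closure ⟨i, rfl⟩
  choose q hq using fun i j => h (b i) (hb i) (b j) (hb j)
  have zerol : ∀ v, φ ![0, v] = 0 := fun v => φ.map_coord_zero 0 rfl
  have zeror : ∀ v, φ ![v, 0] = 0 := fun v => φ.map_coord_zero 1 rfl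
  refine ⟨∏ i, ∏ j, (q i j).den, Finset.prod_pos fun i _ => Finset.prod_pos fun j _ =>
    (q i j).den_pos, fun u hu v hv => ?_⟩
  set N := ∏ i, ∏ j, (q i j).den with hN
  induction hu using AddSubgroup.closure_induction with
  | mem _ hx =>
    obtain ⟨i, rfl⟩ := hx
    induction hv using AddSubgroup.closure_induction with
    | mem _ hy =>
      obtain ⟨j, rfl⟩ := hy
      have hd : (q i j).den ∣ N :=
        (Finset.dvd_prod_of_mem _ (Finset.mem_univ j)).trans
          (Finset.dvd_prod_of_mem (fun i => ∏ j, (q i j).den) (Finset.mem_univ i))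
      obtain ⟨t, ht⟩ := hd
      refine ⟨t * (q i j).num, ?_⟩
      rw [hq, ht]
      have := Rat.den_mul_eq_num (q i j)
      have h2 : ((q i j).den : ℂ) * (q i j : ℂ) = ((q i j).num : ℂ) := by exact_mod_cast this
      push_cast
      linear_combination (t : ℂ) * h2
    | zero => exact ⟨0, by simp [zeror]⟩
    | add x y _ _ hx hy =>
      obtain ⟨m, hm⟩ := hx
      obtain ⟨n, hn⟩ := hy
      exact ⟨m + n, by rw [alternating_add_right]; push_cast; linear_combination hm + hn⟩
    | neg x _ hx =>
      obtain ⟨m, hm⟩ := hx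
      exact ⟨-m, by rw [alternating_neg_right]; push_cast; linear_combination -hm⟩
  | zero => exact ⟨0, by simp [zerol]⟩
  | add x y _ _ hx hy =>
    obtain ⟨m, hm⟩ := hx
    obtain ⟨n, hn⟩ := hy
    exact ⟨m + n, by rw [alternating_add_left]; push_cast; linear_combination hm + hn⟩
  | neg x _ hx =>
    obtain ⟨m, hm⟩ := hx
    exact ⟨-m, by rw [alternating_neg_left]; push_cast; linear_combination -hm⟩

/-- A rational Kähler class polarizes the torus: a multiple of it is a Riemann form. -/
theorem IsKahlerForm.isAbelianVariety {J : V →ₗ[ℝ] V} {φ : TwoForm V} {Λ : AddSubgroup V}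
    (h : IsKahlerForm J φ) (hr : IsRationalClass Λ φ) (hJ : ∀ u, J (J u) = -u)
    (hΛ : ∃ b : Module.Basis (Fin (Module.finrank ℝ V)) ℝ V,
      AddSubgroup.closure (Set.range b) = Λ) : IsAbelianVariety Λ J where
  lattice := hΛ
  complex := hJ
  polarization := by
    obtain ⟨b, rfl⟩ := hΛ
    obtain ⟨N, hN, hint⟩ := hr.exists_integral
    refine ⟨(N : ℝ) • Complex.reLm.compAlternatingMap φ, fun u hu v hv => ?_, fun u v => ?_,
      fun u hu => ?_⟩
    · obtain ⟨n, hn⟩ := hint u hu v hv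
      refine ⟨n, ?_⟩
      have := congrArg Complex.re hn
      simpa using this
    · simp [h.type11.map_map]
    · have := h.pos u hu
      simpa using mul_pos (Nat.cast_pos.2 hN) this

theorem IsAbelianVariety.neg_structure {Λ : AddSubgroup V} {J : V →ₗ[ℝ] V}
    (h : IsAbelianVariety Λ J) : IsAbelianVariety Λ (-J) where
  lattice := h.lattice
  complex u := by simp [h.complex]
  polarization := by
    obtain ⟨E, h₁, h₂, h₃⟩ := h.polarization
    refine ⟨-E, fun u hu v hv => ?_, fun u v => ?_, fun u hu => ?_⟩
    · obtain ⟨n, hn⟩ := h₁ u hu v hv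
      exact ⟨-n, by simp [hn]⟩
    · simp [alternating_neg_left, alternating_neg_right, h₂]
    · simpa [alternating_neg_right] using h₃ u hu

end Forms

/-! ### The roots and their symmetric functions -/

namespace MumfordData

variable (S : MumfordData)

theorem δ_pos {j k : Fin 4} (h : j < k) : 0 < S.δ j k := sub_pos.2 (S.anti h)

theorem D_pos : 0 < S.D := by
  have h₁ := S.δ_pos (j := 0) (k := 1) (by decide)
  have h₂ := S.δ_pos (j := 0) (k := 2) (by decide)
  have h₃ := S.δ_pos (j := 0) (k := 3) (by decide)
  have h₄ := S.δ_pos (j := 1) (k := 2) (by decide)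
  have h₅ := S.δ_pos (j := 1) (k := 3) (by decide)
  have h₆ := S.δ_pos (j := 2) (k := 3) (by decide)
  unfold D
  positivity

/-- The vanishing of the second and third divided differences of the polynomial at its roots. -/
theorem divided_differences :
    S.a * (S.root 0 ^ 2 + S.root 1 ^ 2 + S.root 2 ^ 2 + S.root 0 * S.root 1 + S.root 0 * S.root 2
      + S.root 1 * S.root 2) + S.b = 0 ∧
    S.a * (S.root 0 + S.root 1 + S.root 2 + S.root 3) = 0 := by
  have n01 : S.root 0 - S.root 1 ≠ 0 := (S.δ_pos (j := 0) (k := 1) (by decide)).ne'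
  have n02 : S.root 0 - S.root 2 ≠ 0 := (S.δ_pos (j := 0) (k := 2) (by decide)).ne'
  have n03 : S.root 0 - S.root 3 ≠ 0 := (S.δ_pos (j := 0) (k := 3) (by decide)).ne'
  have n12 : S.root 1 - S.root 2 ≠ 0 := (S.δ_pos (j := 1) (k := 2) (by decide)).ne'
  have n13 : S.root 1 - S.root 3 ≠ 0 := (S.δ_pos (j := 1) (k := 3) (by decide)).ne'
  have n23 : S.root 2 - S.root 3 ≠ 0 := (S.δ_pos (j := 2) (k := 3) (by decide)).ne'
  have r0 := S.isRoot 0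
  have r1 := S.isRoot 1
  have r2 := S.isRoot 2
  have r3 := S.isRoot 3
  have d01 : S.a * (S.root 0 ^ 3 + S.root 0 ^ 2 * S.root 1 + S.root 0 * S.root 1 ^ 2
      + S.root 1 ^ 3) + S.b * (S.root 0 + S.root 1) + S.c = 0 :=
    mul_left_cancel₀ n01 (by linear_combination r0 - r1)
  have d02 : S.a * (S.root 0 ^ 3 + S.root 0 ^ 2 * S.root 2 + S.root 0 * S.root 2 ^ 2
      + S.root 2 ^ 3) + S.b * (S.root 0 + S.root 2) + S.c = 0 :=
    mul_left_cancel₀ n02 (by linear_combination r0 - r2)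
  have d03 : S.a * (S.root 0 ^ 3 + S.root 0 ^ 2 * S.root 3 + S.root 0 * S.root 3 ^ 2
      + S.root 3 ^ 3) + S.b * (S.root 0 + S.root 3) + S.c = 0 :=
    mul_left_cancel₀ n03 (by linear_combination r0 - r3)
  have d012 : S.a * (S.root 0 ^ 2 + S.root 1 ^ 2 + S.root 2 ^ 2 + S.root 0 * S.root 1
      + S.root 0 * S.root 2 + S.root 1 * S.root 2) + S.b = 0 :=
    mul_left_cancel₀ n12 (by linear_combination d01 - d02)
  have d013 : S.a * (S.root 0 ^ 2 + S.root 1 ^ 2 + S.root 3 ^ 2 + S.root 0 * S.root 1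
      + S.root 0 * S.root 3 + S.root 1 * S.root 3) + S.b = 0 :=
    mul_left_cancel₀ n13 (by linear_combination d01 - d03)
  exact ⟨d012, mul_left_cancel₀ n23 (by linear_combination d012 - d013)⟩

theorem a_ne_zero : S.a ≠ 0 := by
  intro ha
  have hb : S.b = 0 := by
    have := S.divided_differences.1
    rw [ha] at this
    exact_mod_cast (by simpa using this : (S.b : ℝ) = 0)
  have hlin : ∀ j, (S.c : ℝ) * S.root j + S.d = 0 := fun j => by
    simpa [ha, hb] using S.isRoot j
  have hc : (S.c : ℝ) = 0 := by
    have n01 : S.root 0 - S.root 1 ≠ 0 := (S.δ_pos (j := 0) (k := 1) (by decide)).ne'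
    exact mul_left_cancel₀ n01 (by linear_combination hlin 0 - hlin 1)
  have hd : (S.d : ℝ) = 0 := by simpa [hc] using hlin 0
  refine S.irreducible.ne_zero ?_
  simp [ha, hb, Rat.cast_eq_zero.1 hc, Rat.cast_eq_zero.1 hd]

theorem root_three : S.root 3 = -(S.root 0 + S.root 1 + S.root 2) := by
  have h := S.divided_differences.2
  have ha : (S.a : ℝ) ≠ 0 := Rat.cast_ne_zero.2 S.a_ne_zero
  linarith [(mul_eq_zero.1 h).resolve_left ha]

/-- A transposition of the roots exchanges `h₃` with `h₂`, and the two are distinct, so `h₃` is not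
zero. -/
theorem h₃_ne_zero : S.h₃ ≠ 0 := by
  intro h3
  obtain ⟨g, hg⟩ := S.exists_aut (Equiv.swap 1 2)
  have halg : ∀ j, (S.root j : ℂ) ∈ algebraicClosure ℚ ℂ := fun j =>
    mem_algebraicClosure_iff.2 ⟨S.poly, S.irreducible.ne_zero, S.poly_eval_root j⟩
  let y : Fin 4 → algebraicClosure ℚ ℂ := fun j => ⟨S.root j, halg j⟩
  have hgy : ∀ j, ((g (y j) : algebraicClosure ℚ ℂ) : ℂ) = S.root (Equiv.swap 1 2 j) :=
    fun j => hg j (y j) rfl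
  have hy : y 0 * y 2 + y 1 * y 3 = 0 := by
    apply Subtype.val_injective
    have : ((S.root 0 * S.root 2 + S.root 1 * S.root 3 : ℝ) : ℂ) = 0 := by
      rw [Complex.ofReal_eq_zero]
      exact h3
    push_cast at this
    exact this
  have h2 : ((g (y 0 * y 2 + y 1 * y 3) : algebraicClosure ℚ ℂ) : ℂ) = 0 := by
    rw [hy, map_zero]; rfl
  simp only [map_add, map_mul, MulMemClass.coe_mul, AddMemClass.coe_add, hgy] at h2
  have e0 : Equiv.swap (1 : Fin 4) 2 0 = 0 := by decide
  have e3 : Equiv.swap (1 : Fin 4) 2 3 = 3 := by decide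
  rw [Equiv.swap_apply_left, Equiv.swap_apply_right, e0, e3] at h2
  have h2' : S.root 0 * S.root 1 + S.root 2 * S.root 3 = 0 := by exact_mod_cast h2
  have n03 := (S.δ_pos (j := 0) (k := 3) (by decide)).ne'
  have n12 := (S.δ_pos (j := 1) (k := 2) (by decide)).ne'
  refine mul_ne_zero n03 n12 ?_
  simp only [h₃] at h3
  simp only [δ]
  linear_combination h2' - h3

/-- The rational numbers, as a subfield of `ℂ`. -/
abbrev rationals : Subfield ℂ := (Rat.castHom ℂ).fieldRange

theorem ratCast_mem (q : ℚ) : (q : ℂ) ∈ rationals := ⟨q, rfl⟩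

theorem exists_of_mem_rationals {t : ℂ} (h : t ∈ rationals) : ∃ q : ℚ, t = q := by
  obtain ⟨q, rfl⟩ := h
  exact ⟨q, rfl⟩

/-- Vieta's formula for `b`, with the last root eliminated through the vanishing of the sum. -/
theorem coeff_b : (S.b : ℂ) = -S.a * ((S.root 0 : ℂ) ^ 2 + S.root 1 ^ 2 + S.root 2 ^ 2
    + S.root 0 * S.root 1 + S.root 0 * S.root 2 + S.root 1 * S.root 2) := by
  have h := S.divided_differences.1
  have h' : (S.b : ℝ) = -S.a * (S.root 0 ^ 2 + S.root 1 ^ 2 + S.root 2 ^ 2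
    + S.root 0 * S.root 1 + S.root 0 * S.root 2 + S.root 1 * S.root 2) := by linarith
  exact_mod_cast h'

theorem coeff_c : (S.c : ℂ) = S.a * ((S.root 0 + S.root 1) * (S.root 0 + S.root 2)
    * (S.root 1 + S.root 2)) := by
  have n01 : S.root 0 - S.root 1 ≠ 0 := (S.δ_pos (j := 0) (k := 1) (by decide)).ne'
  have h : (S.c : ℝ) = S.a * ((S.root 0 + S.root 1) * (S.root 0 + S.root 2)
    * (S.root 1 + S.root 2)) :=
    mul_left_cancel₀ n01 (by
      linear_combination S.isRoot 0 - S.isRoot 1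
        - (S.root 0 - S.root 1) * (S.root 0 + S.root 1) * S.divided_differences.1)
  exact_mod_cast h

theorem coeff_d : (S.d : ℂ) = -S.a * (S.root 0 * S.root 1 * S.root 2
    * (S.root 0 + S.root 1 + S.root 2)) := by
  have hc : (S.c : ℝ) = S.a * ((S.root 0 + S.root 1) * (S.root 0 + S.root 2)
    * (S.root 1 + S.root 2)) := by exact_mod_cast S.coeff_c
  have h : (S.d : ℝ) = -S.a * (S.root 0 * S.root 1 * S.root 2
    * (S.root 0 + S.root 1 + S.root 2)) := by
    linear_combination S.isRoot 0 - S.root 0 ^ 2 * S.divided_differences.1 - S.root 0 * hc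
  exact_mod_cast h

/-- The power sums of the roots are rational. -/
theorem sum_root_pow_mem (n : ℕ) : ∑ j, (S.root j : ℂ) ^ n ∈ rationals := by
  have ha : (S.a : ℂ) ≠ 0 := Rat.cast_ne_zero.2 S.a_ne_zero
  have h3 : (S.root 3 : ℂ) = -(S.root 0 + S.root 1 + S.root 2) := by
    exact_mod_cast S.root_three
  induction n using Nat.strong_induction_on with
  | _ n ih =>
  match n, ih with
  | 0, _ => exact ⟨4, by norm_num⟩
  | 1, _ => exact ⟨0, by simp [Fin.sum_univ_four, h3]⟩
  | 2, _ =>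
    refine ⟨-2 * (S.b / S.a), ?_⟩
    simp only [eq_ratCast, Rat.cast_mul, Rat.cast_div, Fin.sum_univ_four, h3, S.coeff_b]
    push_cast
    field_simp
    ring
  | 3, _ =>
    refine ⟨-3 * (S.c / S.a), ?_⟩
    simp only [eq_ratCast, Rat.cast_mul, Rat.cast_div, Fin.sum_univ_four, h3, S.coeff_c]
    push_cast
    field_simp
    ring
  | m + 4, ih =>
    have hr : ∀ j, (S.root j : ℂ) ^ (m + 4) = -(S.b / S.a * S.root j ^ (m + 2)
        + S.c / S.a * S.root j ^ (m + 1) + S.d / S.a * S.root j ^ m) := by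
      intro j
      have h : (S.a : ℂ) * S.root j ^ 4 + S.b * S.root j ^ 2 + S.c * S.root j + S.d = 0 := by
        exact_mod_cast S.isRoot j
      field_simp
      linear_combination (S.root j : ℂ) ^ m * h
    simp only [hr, Finset.sum_neg_distrib, Finset.sum_add_distrib, ← Finset.mul_sum]
    have hq : ∀ q : ℚ, (q : ℂ) / S.a ∈ rationals := fun q =>
      div_mem (ratCast_mem q) (ratCast_mem _)
    exact neg_mem (add_mem (add_mem (mul_mem (hq _) (ih _ (by omega)))
      (mul_mem (hq _) (ih _ (by omega)))) (mul_mem (hq _) (ih _ (by omega))))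

open Polynomial in
/-- The trace of a polynomial expression in the roots is rational. -/
theorem sum_aeval_mem (f : ℚ[X]) : ∑ j, aeval (S.root j : ℂ) f ∈ rationals := by
  induction f using Polynomial.induction_on' with
  | add p q hp hq => simpa [Finset.sum_add_distrib] using add_mem hp hq
  | monomial n t =>
    simpa [aeval_monomial, ← Finset.mul_sum] using
      mul_mem (ratCast_mem t) (S.sum_root_pow_mem n)

theorem D_sq_mem : (S.D : ℂ) ^ 2 ∈ rationals := by
  have ha : (S.a : ℂ) ≠ 0 := Rat.cast_ne_zero.2 S.a_ne_zero
  have h3 : (S.root 3 : ℂ) = -(S.root 0 + S.root 1 + S.root 2) := by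
    exact_mod_cast S.root_three
  have hb : (S.b / S.a : ℂ) = -((S.root 0 : ℂ) ^ 2 + S.root 1 ^ 2 + S.root 2 ^ 2
    + S.root 0 * S.root 1 + S.root 0 * S.root 2 + S.root 1 * S.root 2) := by
    rw [S.coeff_b]; field_simp
  have hc : (S.c / S.a : ℂ) = (S.root 0 + S.root 1) * (S.root 0 + S.root 2)
    * (S.root 1 + S.root 2) := by
    rw [S.coeff_c]; field_simp
  have hd : (S.d / S.a : ℂ) = -(S.root 0 * S.root 1 * S.root 2
    * (S.root 0 + S.root 1 + S.root 2)) := by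
    rw [S.coeff_d]; field_simp
  -- the discriminant of `X⁴ + B X² + C X + E`
  refine ⟨16 * (S.b / S.a) ^ 4 * (S.d / S.a) - 4 * (S.b / S.a) ^ 3 * (S.c / S.a) ^ 2
    - 128 * (S.b / S.a) ^ 2 * (S.d / S.a) ^ 2 + 144 * (S.b / S.a) * (S.c / S.a) ^ 2 * (S.d / S.a)
    - 27 * (S.c / S.a) ^ 4 + 256 * (S.d / S.a) ^ 3, ?_⟩
  simp only [eq_ratCast]
  push_cast
  simp only [D, δ, hb, hc, hd]
  push_cast
  rw [h3]
  ring

/-- If `{j, k, l, m}` are the four indices, then `x_j x_k + x_l x_m = e₂ + (x_j + x_k)²` with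
`e₂ = b / a`, because `x_l + x_m = -(x_j + x_k)`. -/
theorem h_eqs :
    (S.h₂ : ℂ) = S.b / S.a + (S.root 0 + S.root 1) ^ 2 ∧
    (S.h₂ : ℂ) = S.b / S.a + (S.root 2 + S.root 3) ^ 2 ∧
    (S.h₃ : ℂ) = S.b / S.a + (S.root 0 + S.root 2) ^ 2 ∧
    (S.h₃ : ℂ) = S.b / S.a + (S.root 1 + S.root 3) ^ 2 ∧
    (S.h₄ : ℂ) = S.b / S.a + (S.root 0 + S.root 3) ^ 2 ∧
    (S.h₄ : ℂ) = S.b / S.a + (S.root 1 + S.root 2) ^ 2 := by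
  have ha : (S.a : ℂ) ≠ 0 := Rat.cast_ne_zero.2 S.a_ne_zero
  have h3 : (S.root 3 : ℂ) = -(S.root 0 + S.root 1 + S.root 2) := by
    exact_mod_cast S.root_three
  have hb : (S.b / S.a : ℂ) = -((S.root 0 : ℂ) ^ 2 + S.root 1 ^ 2 + S.root 2 ^ 2
    + S.root 0 * S.root 1 + S.root 0 * S.root 2 + S.root 1 * S.root 2) := by
    rw [S.coeff_b]; field_simp
  simp only [h₂, h₃, h₄, hb]
  push_cast
  rw [h3]
  refine ⟨?_, ?_, ?_, ?_, ?_, ?_⟩ <;> ring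

end MumfordData

/-! ### The field `F` and its embeddings -/

namespace MumfordData

open Polynomial

variable (S : MumfordData)

theorem embedding_x₁ (j : Fin 4) : S.embedding j S.x₁ = (S.root j : ℂ) :=
  (S.exists_embedding j).choose_spec.1

theorem embedding_iD (j : Fin 4) :
    S.embedding j S.iD = (-1 : ℂ) ^ (j : ℕ) * (Complex.I * S.D) :=
  (S.exists_embedding j).choose_spec.2

/-- Since `(i𝔻)²` is rational, every element of `F` has the form `f(x₁) + i𝔻 g(x₁)` with rational
polynomials `f` and `g`. -/
theorem exists_polynomials (p : S.F) :
    ∃ f g : ℚ[X], p = aeval S.x₁ f + S.iD * aeval S.x₁ g := by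
  obtain ⟨q, hq⟩ := exists_of_mem_rationals S.D_sq_mem
  have hI : (Complex.I * (S.D : ℂ)) ^ 2 = -(q : ℂ) := by rw [mul_pow, Complex.I_sq, hq]; ring
  have halg : ∀ t ∈ ({(S.root 0 : ℂ), Complex.I * (S.D : ℂ)} : Set ℂ), IsAlgebraic ℚ t := by
    rintro t (rfl | rfl)
    · exact ⟨S.poly, S.irreducible.ne_zero, S.poly_eval_root 0⟩
    · refine ⟨X ^ 2 + C q, (monic_X_pow_add_C q two_ne_zero).ne_zero, ?_⟩
      simp [hI]
  have hp : (p : ℂ) ∈ Algebra.adjoin ℚ {(S.root 0 : ℂ), Complex.I * (S.D : ℂ)} := by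
    rw [← IntermediateField.adjoin_toSubalgebra_of_isAlgebraic halg]
    exact p.2
  have key : ∃ f g : ℚ[X], (p : ℂ) =
      aeval (S.root 0 : ℂ) f + Complex.I * S.D * aeval (S.root 0 : ℂ) g := by
    generalize (p : ℂ) = t at hp
    induction hp using Algebra.adjoin_induction with
    | mem t ht =>
      rcases ht with rfl | rfl
      · exact ⟨X, 0, by simp⟩
      · exact ⟨0, 1, by simp⟩
    | algebraMap r => exact ⟨C r, 0, by simp⟩
    | add x y _ _ hx hy =>
      obtain ⟨f, g, hx⟩ := hx
      obtain ⟨f', g', hy⟩ := hy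
      exact ⟨f + f', g + g', by rw [hx, hy, map_add, map_add]; ring⟩
    | mul x y _ _ hx hy =>
      obtain ⟨f, g, hx⟩ := hx
      obtain ⟨f', g', hy⟩ := hy
      refine ⟨f * f' - C q * (g * g'), f * g' + g * f', ?_⟩
      rw [hx, hy]
      simp only [map_add, map_sub, map_mul, aeval_C, eq_ratCast]
      linear_combination aeval (S.root 0 : ℂ) g * aeval (S.root 0 : ℂ) g' * hI
  obtain ⟨f, g, h⟩ := key
  refine ⟨f, g, Subtype.val_injective ?_⟩
  have hv : ∀ f : ℚ[X], ((aeval S.x₁ f : S.F) : ℂ) = aeval (S.root 0 : ℂ) f := fun f =>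
    (aeval_algHom_apply S.F.val S.x₁ f).symm
  rw [h]
  simp [hv, iD]

theorem embedding_polynomials (j : Fin 4) (f g : ℚ[X]) :
    S.embedding j (aeval S.x₁ f + S.iD * aeval S.x₁ g) =
      aeval (S.root j : ℂ) f + (-1 : ℂ) ^ (j : ℕ) * (Complex.I * S.D) * aeval (S.root j : ℂ) g := by
  rw [map_add, map_mul, embedding_iD, ← aeval_algHom_apply, ← aeval_algHom_apply, embedding_x₁]

/-- The monomials `x₁ⁿ` and `i𝔻 x₁ⁿ`, `n < 4`, span `F`. -/
def monomialMap : (Fin 4 → ℚ) × (Fin 4 → ℚ) →ₗ[ℚ] S.F :=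
  (Fintype.linearCombination ℚ fun n : Fin 4 => S.x₁ ^ (n : ℕ)).coprod
    (Fintype.linearCombination ℚ fun n : Fin 4 => S.iD * S.x₁ ^ (n : ℕ))

theorem monomialMap_surjective : Function.Surjective S.monomialMap := by
  intro p
  have hx : aeval S.x₁ S.poly = 0 := by
    apply Subtype.val_injective
    exact (aeval_algHom_apply S.F.val S.x₁ S.poly).symm.trans (S.poly_eval_root 0)
  have hdeg : S.poly.natDegree = 4 := by
    have := S.a_ne_zero
    unfold poly
    compute_degree!
  have hred : ∀ f : ℚ[X], ∃ s : Fin 4 → ℚ, aeval S.x₁ f = ∑ n, s n • S.x₁ ^ (n : ℕ) := by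
    intro f
    have h1 : aeval S.x₁ f = aeval S.x₁ (f % S.poly) := by
      conv_lhs => rw [← EuclideanDomain.div_add_mod f S.poly]
      simp [hx]
    have h2 : (f % S.poly).natDegree < 4 := by
      rw [← hdeg]
      exact natDegree_mod_lt f (by rw [hdeg]; norm_num)
    refine ⟨fun n => (f % S.poly).coeff n, ?_⟩
    rw [h1, aeval_eq_sum_range' h2, ← Fin.sum_univ_eq_sum_range
      (fun n => (f % S.poly).coeff n • S.x₁ ^ n)]
  obtain ⟨f, g, rfl⟩ := S.exists_polynomials p
  obtain ⟨s, hs⟩ := hred f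
  obtain ⟨t, ht⟩ := hred g
  refine ⟨(s, t), ?_⟩
  simp [monomialMap, Fintype.linearCombination_apply, hs, ht, Finset.mul_sum]

instance : NumberField S.F where
  to_finiteDimensional := Module.Finite.of_surjective S.monomialMap S.monomialMap_surjective

theorem finrank_F_le : Module.finrank ℚ S.F ≤ 8 := by
  have h := LinearMap.finrank_range_le S.monomialMap
  rw [LinearMap.range_eq_top.2 S.monomialMap_surjective, finrank_top] at h
  simpa using h

theorem z_tmul (j : Fin 4) (r : ℝ) (p : S.F) : S.z j (r ⊗ₜ p) = r * S.embedding j p := rfl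

/-- The coordinates `z_j` together. -/
def zMap : S.V →ₗ[ℝ] (Fin 4 → ℂ) := LinearMap.pi S.z

/-- Real and imaginary parts of prescribed values are interpolated by two real polynomials at
the four roots. -/
theorem zMap_surjective : Function.Surjective S.zMap := by
  intro t
  let P : ℝ[X] := Lagrange.interpolate Finset.univ S.root fun j => (t j).re
  let Q : ℝ[X] := Lagrange.interpolate Finset.univ S.root fun j => (-1) ^ (j : ℕ) * (t j).im / S.D
  have hP : ∀ j, P.eval (S.root j) = (t j).re := fun j =>
    Lagrange.eval_interpolate_at_node _ S.anti.injective.injOn (Finset.mem_univ j)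
  have hQ : ∀ j, Q.eval (S.root j) = (-1) ^ (j : ℕ) * (t j).im / S.D := fun j =>
    Lagrange.eval_interpolate_at_node _ S.anti.injective.injOn (Finset.mem_univ j)
  refine ⟨∑ n ∈ Finset.range (P.natDegree + 1), P.coeff n ⊗ₜ (S.x₁ ^ n) +
    ∑ n ∈ Finset.range (Q.natDegree + 1), Q.coeff n ⊗ₜ (S.iD * S.x₁ ^ n), ?_⟩
  ext j
  have h1 : ∑ n ∈ Finset.range (P.natDegree + 1), (P.coeff n : ℂ) * (S.root j : ℂ) ^ n =
      ((t j).re : ℂ) := by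
    rw [← hP, eval_eq_sum_range]
    push_cast
    rfl
  have h2 : ∑ n ∈ Finset.range (Q.natDegree + 1), (Q.coeff n : ℂ) * (S.root j : ℂ) ^ n =
      (-1) ^ (j : ℕ) * (t j).im / S.D := by
    have : ((Q.eval (S.root j) : ℝ) : ℂ) = (-1) ^ (j : ℕ) * (t j).im / S.D := by
      rw [hQ]; push_cast; rfl
    rw [← this, eval_eq_sum_range]
    push_cast
    rfl
  have hD : (S.D : ℂ) ≠ 0 := Complex.ofReal_ne_zero.2 S.D_pos.ne'
  have hsign : ((-1 : ℂ) ^ (j : ℕ)) * (-1) ^ (j : ℕ) = 1 := by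
    rw [← mul_pow]; simp
  simp only [zMap, LinearMap.pi_apply, map_add, map_sum, z_tmul, map_mul, map_pow, embedding_x₁,
    embedding_iD]
  have h3 : ∑ n ∈ Finset.range (Q.natDegree + 1), (Q.coeff n : ℂ) *
      ((-1 : ℂ) ^ (j : ℕ) * (Complex.I * S.D) * (S.root j : ℂ) ^ n) =
      ((t j).im : ℂ) * Complex.I := by
    have : ∀ n, (Q.coeff n : ℂ) * ((-1 : ℂ) ^ (j : ℕ) * (Complex.I * S.D) * (S.root j : ℂ) ^ n) =
      ((-1 : ℂ) ^ (j : ℕ) * (Complex.I * S.D)) * ((Q.coeff n : ℂ) * (S.root j : ℂ) ^ n) := by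
      intro n; ring
    simp only [this]
    rw [← Finset.mul_sum, h2]
    field_simp
    linear_combination ((t j).im : ℂ) * hsign
  rw [h1, h3]
  exact Complex.re_add_im _

theorem zMap_bijective : Function.Bijective S.zMap := by
  refine ⟨?_, S.zMap_surjective⟩
  have h1 : Module.finrank ℝ S.V ≤ 8 := by
    rw [Module.finrank_baseChange]
    exact S.finrank_F_le
  have h2 : Module.finrank ℝ (Fin 4 → ℂ) = 8 := by
    rw [Module.finrank_pi_fintype]
    simp [Complex.finrank_real_complex]
  have h3 := LinearMap.finrank_range_le S.zMap
  rw [LinearMap.range_eq_top.2 S.zMap_surjective, finrank_top] at h3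
  exact (LinearMap.injective_iff_surjective_of_finrank_eq_finrank (by omega)).2 S.zMap_surjective

/-- `z` as a real-linear isomorphism. -/
def zEquiv : S.V ≃ₗ[ℝ] (Fin 4 → ℂ) := LinearEquiv.ofBijective S.zMap S.zMap_bijective

theorem zEquiv_apply (u : S.V) (j : Fin 4) : S.zEquiv u j = S.z j u := rfl

/-- An integral basis of `F` is a basis of the lattice `Λ`. -/
theorem exists_lattice_basis : ∃ b : Module.Basis (Fin (Module.finrank ℝ S.V)) ℝ S.V,
    AddSubgroup.closure (Set.range b) = S.Λ := by
  let β := Algebra.TensorProduct.basis ℝ (NumberField.integralBasis S.F)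
  have hβ : ∀ i, β i = 1 ⊗ₜ algebraMap (𝓞 S.F) S.F (NumberField.RingOfIntegers.basis S.F i) :=
    fun i => by
      rw [Algebra.TensorProduct.basis_apply, NumberField.integralBasis_apply]
  let e := Fintype.equivFinOfCardEq (Module.finrank_eq_card_basis β).symm
  refine ⟨β.reindex e, ?_⟩
  rw [Module.Basis.range_reindex]
  apply le_antisymm
  · rw [AddSubgroup.closure_le]
    rintro _ ⟨i, rfl⟩
    exact ⟨NumberField.RingOfIntegers.basis S.F i, (hβ i).symm⟩
  · rintro _ ⟨x, rfl⟩
    rw [← (NumberField.RingOfIntegers.basis S.F).sum_repr x, map_sum]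
    refine sum_mem fun i _ => ?_
    rw [map_zsmul]
    exact zsmul_mem (AddSubgroup.subset_closure (Set.mem_range.2 ⟨i, hβ i⟩)) _

theorem mem_Λ {u : S.V} (hu : u ∈ S.Λ) : ∃ p : S.F, u = 1 ⊗ₜ p := by
  obtain ⟨x, rfl⟩ := hu
  exact ⟨algebraMap (𝓞 S.F) S.F x, rfl⟩

end MumfordData

/-! ### Rationality of the classes -/

namespace MumfordData

open Polynomial

variable (S : MumfordData)

theorem z_one_tmul (f g : ℚ[X]) (j : Fin 4) :
    S.z j (1 ⊗ₜ (aeval S.x₁ f + S.iD * aeval S.x₁ g)) =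
      aeval (S.root j : ℂ) f + (-1 : ℂ) ^ (j : ℕ) * (Complex.I * S.D) * aeval (S.root j : ℂ) g := by
  rw [z_tmul, embedding_polynomials, Complex.ofReal_one, one_mul]

theorem conj_aeval (f : ℚ[X]) (x : ℝ) : conj (aeval (x : ℂ) f) = aeval (x : ℂ) f := by
  have h : aeval (x : ℂ) f = ((aeval x f : ℝ) : ℂ) := by
    simpa using aeval_algebraMap_apply ℂ x f
  rw [h, Complex.conj_ofReal]

theorem zbar_one_tmul (f g : ℚ[X]) (j : Fin 4) :
    S.zbar j (1 ⊗ₜ (aeval S.x₁ f + S.iD * aeval S.x₁ g)) =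
      aeval (S.root j : ℂ) f - (-1 : ℂ) ^ (j : ℕ) * (Complex.I * S.D) * aeval (S.root j : ℂ) g := by
  rw [zbar, conjForm_apply, z_one_tmul]
  simp only [map_add, map_mul, map_pow, map_neg, map_one, Complex.conj_I, Complex.conj_ofReal,
    conj_aeval]
  ring

/-- A class is rational once its values on elements `f(x₁) + i𝔻 g(x₁)` of `F` are. -/
theorem isRationalClass_of {φ : TwoForm S.V} (h : ∀ f g f' g' : ℚ[X],
    φ ![1 ⊗ₜ (aeval S.x₁ f + S.iD * aeval S.x₁ g),
      1 ⊗ₜ (aeval S.x₁ f' + S.iD * aeval S.x₁ g')] ∈ rationals) :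
    IsRationalClass S.Λ φ := by
  intro u hu v hv
  obtain ⟨p, rfl⟩ := S.mem_Λ hu
  obtain ⟨q, rfl⟩ := S.mem_Λ hv
  obtain ⟨f, g, rfl⟩ := S.exists_polynomials p
  obtain ⟨f', g', rfl⟩ := S.exists_polynomials q
  exact exists_of_mem_rationals (h f g f' g')

/-- The Galois-invariant pairing `∑ h_{jk} (x_j - x_k) f(x_j) g(x_k)` of two polynomials, where
`h_{jk} = x_j x_k + x_l x_m` equals `e₂ + (x_j + x_k)²`. -/
def pairing (f g : ℚ[X]) : ℂ :=
  ∑ j, ∑ k, (S.b / S.a + (S.root j + S.root k) ^ 2) * (S.root j - S.root k)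
    * aeval (S.root j : ℂ) f * aeval (S.root k : ℂ) g

theorem pairing_mem (f g : ℚ[X]) : S.pairing f g ∈ rationals := by
  let T : ℚ[X] → ℂ := fun f => ∑ j, aeval (S.root j : ℂ) f
  have hT : ∀ f, T f ∈ rationals := S.sum_aeval_mem
  have h : S.pairing f g = S.b / S.a * (T (X * f) * T g - T f * T (X * g))
      + (T (X ^ 3 * f) * T g + T (X ^ 2 * f) * T (X * g) - T (X * f) * T (X ^ 2 * g)
        - T f * T (X ^ 3 * g)) := by
    simp only [pairing, T, Fin.sum_univ_four, map_mul, map_pow, aeval_X]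
    ring
  rw [h]
  exact add_mem (mul_mem (div_mem (ratCast_mem _) (ratCast_mem _))
      (sub_mem (mul_mem (hT _) (hT _)) (mul_mem (hT _) (hT _))))
    (sub_mem (sub_mem (add_mem (mul_mem (hT _) (hT _)) (mul_mem (hT _) (hT _)))
      (mul_mem (hT _) (hT _))) (mul_mem (hT _) (hT _)))

/-- The coefficients of the covariant classes, and those of the conjugate pairs of embeddings,
combine into values of the rational pairing. -/
theorem orbitForm_apply (t s : ℂ) (f g f' g' : ℚ[X]) :
    S.orbitForm t s ![1 ⊗ₜ (aeval S.x₁ f + S.iD * aeval S.x₁ g),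
      1 ⊗ₜ (aeval S.x₁ f' + S.iD * aeval S.x₁ g')] =
    (t + s) * (S.pairing f f' - S.D ^ 2 * S.pairing g g') +
    (t - s) * (Complex.I * S.D) * (S.pairing f g' + S.pairing g f') := by
  obtain ⟨h01, h23, h02, h13, h03, h12⟩ := S.h_eqs
  -- each `h` is replaced by the expression attached to its own pair of roots
  have c01 : (S.h₂ * S.δ 0 1 : ℂ) = (S.b / S.a + (S.root 0 + S.root 1) ^ 2)
    * (S.root 0 - S.root 1) := by rw [h01, δ]; push_cast; ring
  have c23 : (S.h₂ * S.δ 2 3 : ℂ) = (S.b / S.a + (S.root 2 + S.root 3) ^ 2)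
    * (S.root 2 - S.root 3) := by rw [h23, δ]; push_cast; ring
  have c02 : (S.h₃ * S.δ 0 2 : ℂ) = (S.b / S.a + (S.root 0 + S.root 2) ^ 2)
    * (S.root 0 - S.root 2) := by rw [h02, δ]; push_cast; ring
  have c13 : (S.h₃ * S.δ 1 3 : ℂ) = (S.b / S.a + (S.root 1 + S.root 3) ^ 2)
    * (S.root 1 - S.root 3) := by rw [h13, δ]; push_cast; ring
  have c03 : (S.h₄ * S.δ 0 3 : ℂ) = (S.b / S.a + (S.root 0 + S.root 3) ^ 2)
    * (S.root 0 - S.root 3) := by rw [h03, δ]; push_cast; ring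
  have c21 : (S.h₄ * S.δ 2 1 : ℂ) = (S.b / S.a + (S.root 2 + S.root 1) ^ 2)
    * (S.root 2 - S.root 1) := by rw [h12, δ]; push_cast; ring
  have hI : (Complex.I * (S.D : ℂ)) ^ 2 = -(S.D : ℂ) ^ 2 := by rw [mul_pow, Complex.I_sq]; ring
  have hD : (S.D : ℂ) ^ 2 = -(Complex.I * (S.D : ℂ)) ^ 2 := by rw [hI, neg_neg]
  rw [orbitForm, c01, c23, c02, c13, c03, c21, hD]
  simp only [AlternatingMap.smul_apply, AlternatingMap.add_apply, wedge_apply,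
    Matrix.cons_val_zero, Matrix.cons_val_one, smul_eq_mul, z_one_tmul, zbar_one_tmul, pairing,
    Fin.sum_univ_four, Fin.val_zero, Fin.val_one, Fin.val_two,
    show ((3 : Fin 4) : ℕ) = 3 from rfl]
  generalize Complex.I * (S.D : ℂ) = E
  ring

theorem isRationalClass_A₁ : IsRationalClass S.Λ S.A₁ := by
  refine S.isRationalClass_of fun f g f' g' => ?_
  rw [A₁, orbitForm_apply, sub_self, zero_mul, zero_mul, add_zero]
  exact mul_mem (add_mem (one_mem _) (one_mem _))
    (sub_mem (S.pairing_mem _ _) (mul_mem S.D_sq_mem (S.pairing_mem _ _)))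

theorem isRationalClass_A₂ (c : ℤ) : IsRationalClass S.Λ (S.A₂ c) := by
  refine S.isRationalClass_of fun f g f' g' => ?_
  have h : S.A₂ c ![1 ⊗ₜ (aeval S.x₁ f + S.iD * aeval S.x₁ g),
      1 ⊗ₜ (aeval S.x₁ f' + S.iD * aeval S.x₁ g')] =
      -(2 * (c : ℂ) * S.D ^ 2 * (S.pairing f g' + S.pairing g f')) := by
    rw [A₂, orbitForm_apply]
    linear_combination 2 * (c : ℂ) * S.D ^ 2 * (S.pairing f g' + S.pairing g f') * Complex.I_sq
  rw [h]
  exact neg_mem (mul_mem (mul_mem (mul_mem (ofNat_mem _ 2) (intCast_mem _ c)) S.D_sq_mem)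
    (add_mem (S.pairing_mem _ _) (S.pairing_mem _ _)))

/-- `μ_j` is the value at `x_j` of the derivative of the polynomial, divided by the leading
coefficient. -/
theorem μ_eq (j : Fin 4) :
    (S.μ j : ℂ) = 4 * (S.root j : ℂ) ^ 3 + 2 * (S.b / S.a) * S.root j + S.c / S.a := by
  have ha : (S.a : ℂ) ≠ 0 := Rat.cast_ne_zero.2 S.a_ne_zero
  have h3 : (S.root 3 : ℂ) = -(S.root 0 + S.root 1 + S.root 2) := by
    exact_mod_cast S.root_three
  have e0 : (Finset.univ.erase 0 : Finset (Fin 4)) = {1, 2, 3} := by decide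
  have e1 : (Finset.univ.erase 1 : Finset (Fin 4)) = {0, 2, 3} := by decide
  have e2 : (Finset.univ.erase 2 : Finset (Fin 4)) = {0, 1, 3} := by decide
  have e3 : (Finset.univ.erase 3 : Finset (Fin 4)) = {0, 1, 2} := by decide
  rw [S.coeff_b, S.coeff_c]
  fin_cases j <;> simp [μ, e0, e1, e2, e3, δ, h3] <;> field_simp <;> ring

theorem isRationalClass_ω : IsRationalClass S.Λ S.ω := by
  refine S.isRationalClass_of fun f g f' g' => ?_
  have hD : (S.D : ℂ) ≠ 0 := Complex.ofReal_ne_zero.2 S.D_pos.ne'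
  have h : S.ω ![1 ⊗ₜ (aeval S.x₁ f + S.iD * aeval S.x₁ g),
      1 ⊗ₜ (aeval S.x₁ f' + S.iD * aeval S.x₁ g')] =
      -2 * ∑ j, aeval (S.root j : ℂ)
        ((4 * X ^ 3 + C (2 * (S.b / S.a)) * X + C (S.c / S.a)) * (g * f' - f * g')) := by
    have hΔ : (S.Δ : ℂ) = S.D ^ 2 := by rw [Δ]; push_cast; rfl
    simp only [ω, hΔ, AlternatingMap.smul_apply, AlternatingMap.add_apply,
      AlternatingMap.sub_apply, wedge_apply,
      Matrix.cons_val_zero, Matrix.cons_val_one, smul_eq_mul, z_one_tmul, zbar_one_tmul,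
      Fin.sum_univ_four, Fin.val_zero, Fin.val_one, Fin.val_two,
      show ((3 : Fin 4) : ℕ) = 3 from rfl, map_mul, map_add, map_sub, map_pow, aeval_X, aeval_C,
      eq_ratCast, μ_eq, map_ofNat, Rat.cast_div]
    field_simp
    ring_nf
    simp only [Complex.I_sq]
    ring
  rw [h]
  exact mul_mem (neg_mem (ofNat_mem _ 2)) (S.sum_aeval_mem _)

end MumfordData

/-! ### The adapted coordinates -/

section Substitution

variable {K : Type*} [Field K] {x₀ x₁ x₂ x₃ h₂ h₃ h₄ a b c d k : K}

/-- The covariant two-form after the substitution of the adapted coordinates. -/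
theorem CoeffData.covariant_identity (H : CoeffData x₀ x₁ x₂ x₃ h₂ h₃ h₄ a b c d k)
    {y₀ y₁ y₂ y₃ y₀' y₁' y₂' y₃' p₀ q₁ p₂ q₃ p₀' q₁' p₂' q₃' : K}
    (e₀ : y₀ = p₀ + (a * q₁ + b * q₃)) (e₁ : y₁ = q₁ + k * (d * p₀ - b * p₂))
    (e₂ : y₂ = p₂ + (c * q₁ + d * q₃)) (e₃ : y₃ = q₃ + k * (a * p₂ - c * p₀))
    (e₀' : y₀' = p₀' + (a * q₁' + b * q₃')) (e₁' : y₁' = q₁' + k * (d * p₀' - b * p₂'))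
    (e₂' : y₂' = p₂' + (c * q₁' + d * q₃')) (e₃' : y₃' = q₃' + k * (a * p₂' - c * p₀')) :
    h₃ ^ 2 * (h₃ * (x₀ - x₂) * (y₀ * y₂' - y₀' * y₂) + h₃ * (x₁ - x₃) * (y₁ * y₃' - y₁' * y₃)
      + h₂ * (x₀ - x₁) * (y₀ * y₁' - y₀' * y₁) + h₂ * (x₂ - x₃) * (y₂ * y₃' - y₂' * y₃)
      + h₄ * (x₀ - x₃) * (y₀ * y₃' - y₀' * y₃) + h₄ * (x₂ - x₁) * (y₂ * y₁' - y₂' * y₁)) =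
    4 * ((x₀ - x₁) ^ 2 * (x₁ - x₂) ^ 2 * (x₀ - x₃) ^ 2 * (x₂ - x₃) * (p₀ * q₁' - p₀' * q₁)
      - (x₀ - x₁) ^ 2 * (x₁ - x₂) ^ 2 * (x₀ - x₃) * (x₂ - x₃) ^ 2 * (q₁ * p₂' - q₁' * p₂)
      + (x₀ - x₁) * (x₁ - x₂) ^ 2 * (x₀ - x₃) ^ 2 * (x₂ - x₃) ^ 2 * (p₂ * q₃' - p₂' * q₃)
      + (x₀ - x₁) ^ 2 * (x₁ - x₂) * (x₀ - x₃) ^ 2 * (x₂ - x₃) ^ 2 * (q₃ * p₀' - q₃' * p₀)) := by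
  obtain ⟨E₀₁, E₀₂, E₀₃, E₁₂, E₁₃, E₂₃⟩ := H.covariant_coeffs
  subst e₀ e₁ e₂ e₃ e₀' e₁' e₂' e₃'
  linear_combination (p₀ * q₁' - p₀' * q₁) * E₀₁ + h₃ ^ 2 * (p₀ * p₂' - p₀' * p₂) * E₀₂
    + (p₀ * q₃' - p₀' * q₃) * E₀₃ + (q₁ * p₂' - q₁' * p₂) * E₁₂
    + h₃ ^ 2 * (q₁ * q₃' - q₁' * q₃) * E₁₃ + (p₂ * q₃' - p₂' * q₃) * E₂₃

/-- The Hermitian form after the substitution of the adapted coordinates; `Y_j`, `P_j`, `Q_j` stand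
for the conjugates of `y_j`, `p_j`, `q_j`. -/
theorem CoeffData.hermitian_identity (H : CoeffData x₀ x₁ x₂ x₃ h₂ h₃ h₄ a b c d k)
    {μ₀ μ₁ μ₂ μ₃ y₀ y₁ y₂ y₃ Y₀ Y₁ Y₂ Y₃ p₀ q₁ p₂ q₃ P₀ Q₁ P₂ Q₃ : K}
    (hμ₀ : μ₀ = (x₀ - x₁) * (x₀ - x₂) * (x₀ - x₃)) (hμ₁ : μ₁ = (x₁ - x₀) * (x₁ - x₂) * (x₁ - x₃))
    (hμ₂ : μ₂ = (x₂ - x₀) * (x₂ - x₁) * (x₂ - x₃))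
    (hμ₃ : μ₃ = (x₃ - x₀) * (x₃ - x₁) * (x₃ - x₂))
    (e₀ : y₀ = p₀ + (a * q₁ + b * q₃)) (e₁ : y₁ = q₁ + k * (d * p₀ - b * p₂))
    (e₂ : y₂ = p₂ + (c * q₁ + d * q₃)) (e₃ : y₃ = q₃ + k * (a * p₂ - c * p₀))
    (f₀ : Y₀ = P₀ + (a * Q₁ + b * Q₃)) (f₁ : Y₁ = Q₁ + k * (d * P₀ - b * P₂))
    (f₂ : Y₂ = P₂ + (c * Q₁ + d * Q₃)) (f₃ : Y₃ = Q₃ + k * (a * P₂ - c * P₀)) :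
    h₃ ^ 2 * (μ₀ * (y₀ * Y₀) + μ₁ * (y₁ * Y₁) + μ₂ * (y₂ * Y₂) + μ₃ * (y₃ * Y₃)) =
    -(4 * ((x₀ - x₁) ^ 2 * (x₀ - x₂) * (x₁ - x₂) * (x₀ - x₃) ^ 2 * (x₂ - x₃) * (p₀ * P₀)
      - (x₀ - x₁) ^ 2 * (x₁ - x₂) ^ 2 * (x₀ - x₃) * (x₁ - x₃) * (x₂ - x₃) * (q₁ * Q₁)
      + (x₀ - x₁) * (x₀ - x₂) * (x₁ - x₂) ^ 2 * (x₀ - x₃) * (x₂ - x₃) ^ 2 * (p₂ * P₂)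
      - (x₀ - x₁) * (x₁ - x₂) * (x₀ - x₃) ^ 2 * (x₁ - x₃) * (x₂ - x₃) ^ 2 * (q₃ * Q₃))) := by
  obtain ⟨⟨E₀, E₁, E₂, E₃⟩, E₀₁, E₀₂, E₀₃, E₁₂, E₁₃, E₂₃⟩ := H.hermitian_coeffs hμ₀ hμ₁ hμ₂ hμ₃
  clear hμ₀ hμ₁ hμ₂ hμ₃
  subst e₀ e₁ e₂ e₃ f₀ f₁ f₂ f₃
  linear_combination (p₀ * P₀) * E₀ + (q₁ * Q₁) * E₁ + (p₂ * P₂) * E₂ + (q₃ * Q₃) * E₃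
    + h₃ ^ 2 * ((p₀ * Q₁ + q₁ * P₀) * E₀₁ - (p₀ * P₂ + p₂ * P₀) * E₀₂
      + (p₀ * Q₃ + q₃ * P₀) * E₀₃ + (q₁ * P₂ + p₂ * Q₁) * E₁₂
      + (q₁ * Q₃ + q₃ * Q₁) * E₁₃ + (p₂ * Q₃ + q₃ * P₂) * E₂₃)

end Substitution

namespace MumfordData

variable (S : MumfordData)

theorem coeffData : CoeffData (S.root 0 : ℂ) (S.root 1) (S.root 2) (S.root 3) S.h₂ S.h₃ S.h₄
    (S.αStar 0 0) (S.αStar 0 1) (S.αStar 1 0) (S.αStar 1 1) (S.δ 0 2 / S.δ 1 3) := by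
  have h3 : (S.h₃ : ℂ) ≠ 0 := Complex.ofReal_ne_zero.2 S.h₃_ne_zero
  have n02 : (S.δ 0 2 : ℂ) ≠ 0 :=
    Complex.ofReal_ne_zero.2 (S.δ_pos (j := 0) (k := 2) (by decide)).ne'
  have n13 : (S.δ 1 3 : ℂ) ≠ 0 :=
    Complex.ofReal_ne_zero.2 (S.δ_pos (j := 1) (k := 3) (by decide)).ne'
  have hδ : ∀ j k, (S.root j : ℂ) - S.root k = S.δ j k := fun j k => by
    rw [δ, Complex.ofReal_sub]
  refine ⟨by exact_mod_cast S.root_three, by simp [h₂], by simp [h₃], by simp [h₄], h3, ?_, ?_,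
    ?_, ?_, ?_, ?_, ?_⟩ <;> simp only [hδ]
  · exact n02
  · exact n13
  all_goals
    simp only [αStar, Matrix.smul_apply, Matrix.of_apply, Matrix.cons_val', Matrix.cons_val_zero,
      Matrix.cons_val_one, Matrix.cons_val_fin_one, smul_eq_mul]
    field_simp

theorem conj_αStar (i j : Fin 2) : conj (S.αStar i j) = S.αStar i j := by
  fin_cases i <;> fin_cases j <;> simp [αStar, Complex.conj_ofNat]

theorem αStar_map_conj : S.αStar.map conj = S.αStar := by
  ext i j
  exact S.conj_αStar i j

theorem αTilde_map_conj : (S.αTilde S.αStar).map conj = S.αTilde S.αStar := by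
  rw [αTilde, αStar_map_conj, Matrix.adjugate_fin_two]
  ext i j
  fin_cases i <;> fin_cases j <;> simp [conj_αStar]

variable {S} {w : S.V ≃ₗ[ℝ] (Fin 4 → ℂ)}

theorem isAdapted_iff : S.IsAdapted S.αStar w ↔ ∀ u,
    S.z 0 u = w u 0 + (S.αStar 0 0 * conj (w u 1) + S.αStar 0 1 * conj (w u 3)) ∧
    S.z 1 u = w u 1 + S.δ 0 2 / S.δ 1 3 *
      (S.αStar 1 1 * conj (w u 0) - S.αStar 0 1 * conj (w u 2)) ∧
    S.z 2 u = w u 2 + (S.αStar 1 0 * conj (w u 1) + S.αStar 1 1 * conj (w u 3)) ∧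
    S.z 3 u = w u 3 + S.δ 0 2 / S.δ 1 3 *
      (S.αStar 0 0 * conj (w u 2) - S.αStar 1 0 * conj (w u 0)) := by
  unfold IsAdapted
  refine forall_congr' fun u => ?_
  rw [αTilde_map_conj, αTilde, αStar_map_conj, Matrix.adjugate_fin_two]
  simp only [funext_iff, Fin.forall_fin_two, Matrix.cons_val_zero, Matrix.cons_val_one,
    Pi.add_apply, Matrix.mulVec, dotProduct, Fin.sum_univ_two, Matrix.smul_apply, Matrix.of_apply,
    Matrix.cons_val', Matrix.cons_val_fin_one, smul_eq_mul]
  constructor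
  · rintro ⟨⟨h0, h2⟩, h1, h3⟩
    exact ⟨h0, by rw [h1]; ring, h2, by rw [h3]; ring⟩
  · rintro ⟨h0, h1, h2, h3⟩
    exact ⟨⟨h0, h2⟩, by rw [h1]; ring, by rw [h3]; ring⟩

/-- The conjugates of the adapted coordinate equations; the coefficients are real. -/
theorem IsAdapted.zbar (hw : S.IsAdapted S.αStar w) (u : S.V) :
    S.zbar 0 u = conj (w u 0) + (S.αStar 0 0 * w u 1 + S.αStar 0 1 * w u 3) ∧
    S.zbar 1 u = conj (w u 1) + S.δ 0 2 / S.δ 1 3 *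
      (S.αStar 1 1 * w u 0 - S.αStar 0 1 * w u 2) ∧
    S.zbar 2 u = conj (w u 2) + (S.αStar 1 0 * w u 1 + S.αStar 1 1 * w u 3) ∧
    S.zbar 3 u = conj (w u 3) + S.δ 0 2 / S.δ 1 3 *
      (S.αStar 0 0 * w u 2 - S.αStar 1 0 * w u 0) := by
  obtain ⟨h0, h1, h2, h3⟩ := isAdapted_iff.1 hw u
  simp only [MumfordData.zbar, conjForm_apply, h0, h1, h2, h3, map_add, map_sub, map_mul,
    map_div₀, conj_αStar, Complex.conj_conj, Complex.conj_ofReal, and_self]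

/-- The map that expresses `z` through `w`. -/
def coordChange (S : MumfordData) : (Fin 4 → ℂ) →ₗ[ℝ] (Fin 4 → ℂ) where
  toFun t := ![t 0 + (S.αStar 0 0 * conj (t 1) + S.αStar 0 1 * conj (t 3)),
    t 1 + S.δ 0 2 / S.δ 1 3 * (S.αStar 1 1 * conj (t 0) - S.αStar 0 1 * conj (t 2)),
    t 2 + (S.αStar 1 0 * conj (t 1) + S.αStar 1 1 * conj (t 3)),
    t 3 + S.δ 0 2 / S.δ 1 3 * (S.αStar 0 0 * conj (t 2) - S.αStar 1 0 * conj (t 0))]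
  map_add' s t := by
    ext j
    fin_cases j <;> simp <;> ring
  map_smul' r t := by
    ext j
    fin_cases j <;> simp <;> ring

theorem coordChange_injective (S : MumfordData) : Function.Injective S.coordChange := by
  rw [injective_iff_map_eq_zero]
  intro t ht
  have e0 : t 0 + (S.αStar 0 0 * conj (t 1) + S.αStar 0 1 * conj (t 3)) = 0 := congrFun ht 0
  have e1 : t 1 + S.δ 0 2 / S.δ 1 3 *
    (S.αStar 1 1 * conj (t 0) - S.αStar 0 1 * conj (t 2)) = 0 := congrFun ht 1
  have e2 : t 2 + (S.αStar 1 0 * conj (t 1) + S.αStar 1 1 * conj (t 3)) = 0 := congrFun ht 2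
  have e3 : t 3 + S.δ 0 2 / S.δ 1 3 *
    (S.αStar 0 0 * conj (t 2) - S.αStar 1 0 * conj (t 0)) = 0 := congrFun ht 3
  have f1 := congrArg conj e1
  have f3 := congrArg conj e3
  simp only [map_add, map_sub, map_mul, map_div₀, conj_αStar, Complex.conj_conj,
    Complex.conj_ofReal, map_zero] at f1 f3
  have hdet : 1 - (S.δ 0 2 / S.δ 1 3 : ℂ) *
      (S.αStar 0 0 * S.αStar 1 1 - S.αStar 0 1 * S.αStar 1 0) ≠ 0 := by
    intro h
    have h' := S.coeffData.det_eq
    rw [h, zero_mul] at h'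
    have n01 := (S.δ_pos (j := 0) (k := 1) (by decide)).ne'
    have n12 := (S.δ_pos (j := 1) (k := 2) (by decide)).ne'
    have n03 := (S.δ_pos (j := 0) (k := 3) (by decide)).ne'
    have n23 := (S.δ_pos (j := 2) (k := 3) (by decide)).ne'
    have hp : S.δ 0 1 * S.δ 1 2 * S.δ 0 3 * S.δ 2 3 ≠ 0 := by positivity
    apply hp
    apply Complex.ofReal_injective
    simp only [δ]
    push_cast
    linear_combination (1 / 4) * h'
  have h0 : t 0 = 0 := (mul_eq_zero.1 (by
    linear_combination e0 - S.αStar 0 0 * f1 - S.αStar 0 1 * f3)).resolve_left hdet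
  have h2 : t 2 = 0 := (mul_eq_zero.1 (by
    linear_combination e2 - S.αStar 1 0 * f1 - S.αStar 1 1 * f3)).resolve_left hdet
  have h1 : t 1 = 0 := by simpa [h0, h2] using e1
  have h3 : t 3 = 0 := by simpa [h0, h2] using e3
  ext j
  fin_cases j <;> assumption

theorem isAdapted_iff_coordChange :
    S.IsAdapted S.αStar w ↔ ∀ u, S.coordChange (w u) = S.zEquiv u := by
  rw [isAdapted_iff]
  refine forall_congr' fun u => ?_
  simp only [funext_iff, Fin.forall_fin_succ, zEquiv_apply, eq_comm (a := S.coordChange _ _)]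
  simp [coordChange]

theorem existsUnique_isAdapted (S : MumfordData) :
    ∃! w : S.V ≃ₗ[ℝ] (Fin 4 → ℂ), S.IsAdapted S.αStar w := by
  let T := LinearEquiv.ofInjectiveEndo S.coordChange S.coordChange_injective
  have hT : ∀ t, T t = S.coordChange t := fun t => rfl
  refine ⟨S.zEquiv.trans T.symm, ?_, fun w hw => ?_⟩
  · refine isAdapted_iff_coordChange.2 fun u => ?_
    rw [← hT, LinearEquiv.trans_apply, LinearEquiv.apply_symm_apply]
  · ext1 u
    rw [LinearEquiv.trans_apply, LinearEquiv.eq_symm_apply, hT]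
    exact isAdapted_iff_coordChange.1 hw u

end MumfordData

/-! ### The classes in the adapted coordinates -/

namespace MumfordData

variable {S : MumfordData} {w : S.V ≃ₗ[ℝ] (Fin 4 → ℂ)}

theorem IsAdapted.orbitForm_eq (hw : S.IsAdapted S.αStar w) (t s : ℂ) :
    ((S.h₃ : ℂ) ^ 2 / 4) • S.orbitForm t s =
      t • ((S.δ 0 1 ^ 2 * S.δ 1 2 ^ 2 * S.δ 0 3 ^ 2 * S.δ 2 3) • dw w 0 ⋏ dwbar w 1
        - (S.δ 0 1 ^ 2 * S.δ 1 2 ^ 2 * S.δ 0 3 * S.δ 2 3 ^ 2) • dwbar w 1 ⋏ dw w 2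
        + (S.δ 0 1 * S.δ 1 2 ^ 2 * S.δ 0 3 ^ 2 * S.δ 2 3 ^ 2) • dw w 2 ⋏ dwbar w 3
        + (S.δ 0 1 ^ 2 * S.δ 1 2 * S.δ 0 3 ^ 2 * S.δ 2 3 ^ 2) • dwbar w 3 ⋏ dw w 0) +
      s • ((S.δ 0 1 ^ 2 * S.δ 1 2 ^ 2 * S.δ 0 3 ^ 2 * S.δ 2 3) • dwbar w 0 ⋏ dw w 1
        - (S.δ 0 1 ^ 2 * S.δ 1 2 ^ 2 * S.δ 0 3 * S.δ 2 3 ^ 2) • dw w 1 ⋏ dwbar w 2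
        + (S.δ 0 1 * S.δ 1 2 ^ 2 * S.δ 0 3 ^ 2 * S.δ 2 3 ^ 2) • dwbar w 2 ⋏ dw w 3
        + (S.δ 0 1 ^ 2 * S.δ 1 2 * S.δ 0 3 ^ 2 * S.δ 2 3 ^ 2) • dw w 3 ⋏ dwbar w 0) := by
  ext m
  obtain ⟨e0, e1, e2, e3⟩ := isAdapted_iff.1 hw (m 0)
  obtain ⟨f0, f1, f2, f3⟩ := hw.zbar (m 0)
  obtain ⟨e0', e1', e2', e3'⟩ := isAdapted_iff.1 hw (m 1)
  obtain ⟨f0', f1', f2', f3'⟩ := hw.zbar (m 1)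
  have hB := S.coeffData.covariant_identity e0 f1 e2 f3 e0' f1' e2' f3'
  have hBbar := S.coeffData.covariant_identity f0 e1 f2 e3 f0' e1' f2' e3'
  have hδ : ∀ j k, (S.root j : ℂ) - S.root k = S.δ j k := fun j k => by
    rw [δ, Complex.ofReal_sub]
  simp only [hδ] at hB hBbar
  clear e0 e1 e2 e3 f0 f1 f2 f3 e0' e1' e2' e3' f0' f1' f2' f3' hδ
  simp only [orbitForm, AlternatingMap.smul_apply, AlternatingMap.add_apply,
    AlternatingMap.sub_apply, wedge_apply, dw_apply, dwbar_apply, smul_eq_mul, Complex.real_smul]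
  push_cast
  linear_combination (t / 4) * hB + (s / 4) * hBbar

theorem IsAdapted.A₁_eq (hw : S.IsAdapted S.αStar w) :
    ((S.h₃ : ℂ) ^ 2 / 4) • S.A₁ =
          (S.δ 0 1 ^ 2 * S.δ 1 2 ^ 2 * S.δ 0 3 ^ 2 * S.δ 2 3) • dw w 0 ⋏ dwbar w 1
        - (S.δ 0 1 ^ 2 * S.δ 1 2 ^ 2 * S.δ 0 3 * S.δ 2 3 ^ 2) • dw w 1 ⋏ dwbar w 2
        + (S.δ 0 1 * S.δ 1 2 ^ 2 * S.δ 0 3 ^ 2 * S.δ 2 3 ^ 2) • dw w 2 ⋏ dwbar w 3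
        + (S.δ 0 1 ^ 2 * S.δ 1 2 * S.δ 0 3 ^ 2 * S.δ 2 3 ^ 2) • dw w 3 ⋏ dwbar w 0
        + (S.δ 0 1 ^ 2 * S.δ 1 2 ^ 2 * S.δ 0 3 ^ 2 * S.δ 2 3) • dwbar w 0 ⋏ dw w 1
        - (S.δ 0 1 ^ 2 * S.δ 1 2 ^ 2 * S.δ 0 3 * S.δ 2 3 ^ 2) • dwbar w 1 ⋏ dw w 2
        + (S.δ 0 1 * S.δ 1 2 ^ 2 * S.δ 0 3 ^ 2 * S.δ 2 3 ^ 2) • dwbar w 2 ⋏ dw w 3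
        + (S.δ 0 1 ^ 2 * S.δ 1 2 * S.δ 0 3 ^ 2 * S.δ 2 3 ^ 2) • dwbar w 3 ⋏ dw w 0 := by
  rw [A₁, hw.orbitForm_eq, one_smul, one_smul]
  abel

theorem IsAdapted.A₂_eq (hw : S.IsAdapted S.αStar w) (c : ℤ) :
    ((S.h₃ : ℂ) ^ 2 / (4 * Complex.I * S.D)) • S.A₂ c =
        (c : ℂ) •
        ((S.δ 0 1 ^ 2 * S.δ 1 2 ^ 2 * S.δ 0 3 ^ 2 * S.δ 2 3) • dw w 0 ⋏ dwbar w 1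
        + (S.δ 0 1 ^ 2 * S.δ 1 2 ^ 2 * S.δ 0 3 * S.δ 2 3 ^ 2) • dw w 1 ⋏ dwbar w 2
        + (S.δ 0 1 * S.δ 1 2 ^ 2 * S.δ 0 3 ^ 2 * S.δ 2 3 ^ 2) • dw w 2 ⋏ dwbar w 3
        - (S.δ 0 1 ^ 2 * S.δ 1 2 * S.δ 0 3 ^ 2 * S.δ 2 3 ^ 2) • dw w 3 ⋏ dwbar w 0
        - (S.δ 0 1 ^ 2 * S.δ 1 2 ^ 2 * S.δ 0 3 ^ 2 * S.δ 2 3) • dwbar w 0 ⋏ dw w 1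
        - (S.δ 0 1 ^ 2 * S.δ 1 2 ^ 2 * S.δ 0 3 * S.δ 2 3 ^ 2) • dwbar w 1 ⋏ dw w 2
        - (S.δ 0 1 * S.δ 1 2 ^ 2 * S.δ 0 3 ^ 2 * S.δ 2 3 ^ 2) • dwbar w 2 ⋏ dw w 3
        + (S.δ 0 1 ^ 2 * S.δ 1 2 * S.δ 0 3 ^ 2 * S.δ 2 3 ^ 2) • dwbar w 3 ⋏ dw w 0) := by
  have hD : (S.D : ℂ) ≠ 0 := Complex.ofReal_ne_zero.2 S.D_pos.ne'
  have h : (S.h₃ : ℂ) ^ 2 / (4 * Complex.I * S.D) =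
      1 / (Complex.I * S.D) * ((S.h₃ : ℂ) ^ 2 / 4) := by
    field_simp [Complex.I_ne_zero]
  have hs : 1 / (Complex.I * S.D) * (Complex.I * c * S.D) = (c : ℂ) := by
    field_simp [Complex.I_ne_zero]
  rw [A₂, h, mul_smul, hw.orbitForm_eq, smul_add, smul_smul, smul_smul, mul_neg, hs, neg_smul,
    ← sub_eq_add_neg, ← smul_sub]
  congr 1
  abel

theorem μ_factors (S : MumfordData) :
    (S.μ 0 : ℂ) = ((S.root 0 : ℂ) - S.root 1) * (S.root 0 - S.root 2) * (S.root 0 - S.root 3) ∧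
    (S.μ 1 : ℂ) = ((S.root 1 : ℂ) - S.root 0) * (S.root 1 - S.root 2) * (S.root 1 - S.root 3) ∧
    (S.μ 2 : ℂ) = ((S.root 2 : ℂ) - S.root 0) * (S.root 2 - S.root 1) * (S.root 2 - S.root 3) ∧
    (S.μ 3 : ℂ) = ((S.root 3 : ℂ) - S.root 0) * (S.root 3 - S.root 1) * (S.root 3 - S.root 2) := by
  have e0 : (Finset.univ.erase 0 : Finset (Fin 4)) = {1, 2, 3} := by decide
  have e1 : (Finset.univ.erase 1 : Finset (Fin 4)) = {0, 2, 3} := by decide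
  have e2 : (Finset.univ.erase 2 : Finset (Fin 4)) = {0, 1, 3} := by decide
  have e3 : (Finset.univ.erase 3 : Finset (Fin 4)) = {0, 1, 2} := by decide
  simp [μ, e0, e1, e2, e3, δ, mul_assoc]

theorem IsAdapted.ω_eq (hw : S.IsAdapted S.αStar w) :
    (S.Δ * (S.h₃ : ℂ) ^ 2 / (4 * Complex.I * S.D)) • S.ω =
        -((S.δ 0 1 ^ 2 * S.δ 0 2 * S.δ 1 2 * S.δ 0 3 ^ 2 * S.δ 2 3) •
            dw w 0 ⋏ dwbar w 0
        + (S.δ 0 1 ^ 2 * S.δ 1 2 ^ 2 * S.δ 0 3 * S.δ 1 3 * S.δ 2 3) •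
            dw w 1 ⋏ dwbar w 1
        + (S.δ 0 1 * S.δ 0 2 * S.δ 1 2 ^ 2 * S.δ 0 3 * S.δ 2 3 ^ 2) •
            dw w 2 ⋏ dwbar w 2
        + (S.δ 0 1 * S.δ 1 2 * S.δ 0 3 ^ 2 * S.δ 1 3 * S.δ 2 3 ^ 2) •
            dw w 3 ⋏ dwbar w 3) := by
  have hD : (S.D : ℂ) ≠ 0 := Complex.ofReal_ne_zero.2 S.D_pos.ne'
  have hΔ : (S.Δ : ℂ) = S.D ^ 2 := by rw [Δ]; push_cast; rfl
  have hc : (S.Δ * (S.h₃ : ℂ) ^ 2 / (4 * Complex.I * S.D)) * (Complex.I * S.D / S.Δ) =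
      (S.h₃ : ℂ) ^ 2 / 4 := by
    rw [hΔ]
    field_simp [Complex.I_ne_zero]
  rw [ω, smul_smul, hc]
  ext m
  obtain ⟨e0, e1, e2, e3⟩ := isAdapted_iff.1 hw (m 0)
  obtain ⟨f0, f1, f2, f3⟩ := hw.zbar (m 0)
  obtain ⟨e0', e1', e2', e3'⟩ := isAdapted_iff.1 hw (m 1)
  obtain ⟨f0', f1', f2', f3'⟩ := hw.zbar (m 1)
  obtain ⟨m0, m1, m2, m3⟩ := S.μ_factors
  have h₁ := S.coeffData.hermitian_identity m0 m1 m2 m3 e0 f1 e2 f3 f0' e1' f2' e3'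
  have h₂ := S.coeffData.hermitian_identity m0 m1 m2 m3 e0' f1' e2' f3' f0 e1 f2 e3
  have hδ : ∀ j k, (S.root j : ℂ) - S.root k = S.δ j k := fun j k => by
    rw [δ, Complex.ofReal_sub]
  simp only [hδ] at h₁ h₂
  clear e0 e1 e2 e3 f0 f1 f2 f3 e0' e1' e2' e3' f0' f1' f2' f3' hδ m0 m1 m2 m3
  simp only [AlternatingMap.smul_apply, AlternatingMap.add_apply, AlternatingMap.neg_apply,
    AlternatingMap.sub_apply, wedge_apply, dw_apply, dwbar_apply, smul_eq_mul, Complex.real_smul]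
  push_cast
  linear_combination (1 / 4) * h₁ - (1 / 4) * h₂

theorem IsAdapted.isType11_A₁ (hw : S.IsAdapted S.αStar w) :
    IsType11 (coordComplexStructure w) S.A₁ := by
  have h3 : (S.h₃ : ℂ) ≠ 0 := Complex.ofReal_ne_zero.2 S.h₃_ne_zero
  refine IsType11.of_smul (t := (S.h₃ : ℂ) ^ 2 / 4) (by simpa using h3) ?_
  rw [hw.A₁_eq]
  have P := fun (t : ℝ) j k => (isType11_dw_dwbar w j k).real_smul t
  have Q := fun (t : ℝ) j k => (isType11_dwbar_dw w j k).real_smul t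
  exact (((((((P _ _ _).sub (P _ _ _)).add (P _ _ _)).add (P _ _ _)).add (Q _ _ _)).sub
    (Q _ _ _)).add (Q _ _ _)).add (Q _ _ _)

theorem IsAdapted.isType11_A₂ (hw : S.IsAdapted S.αStar w) (c : ℤ) :
    IsType11 (coordComplexStructure w) (S.A₂ c) := by
  have h3 : (S.h₃ : ℂ) ≠ 0 := Complex.ofReal_ne_zero.2 S.h₃_ne_zero
  have hD : (S.D : ℂ) ≠ 0 := Complex.ofReal_ne_zero.2 S.D_pos.ne'
  refine IsType11.of_smul (t := (S.h₃ : ℂ) ^ 2 / (4 * Complex.I * S.D))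
    (by simp [h3, hD]) ?_
  rw [hw.A₂_eq]
  have P := fun (t : ℝ) j k => (isType11_dw_dwbar w j k).real_smul t
  have Q := fun (t : ℝ) j k => (isType11_dwbar_dw w j k).real_smul t
  exact IsType11.smul _ ((((((((P _ _ _).add (P _ _ _)).add (P _ _ _)).sub (P _ _ _)).sub
    (Q _ _ _)).sub (Q _ _ _)).sub (Q _ _ _)).add (Q _ _ _))

/-- In the adapted coordinates `-ω` is `i ∑ κ_j dw_j dw̄_j` with positive `κ_j`. -/
theorem IsAdapted.isKahlerForm (hw : S.IsAdapted S.αStar w) :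
    IsKahlerForm (coordComplexStructure w) (-S.ω) := by
  have n01 := S.δ_pos (j := 0) (k := 1) (by decide)
  have n02 := S.δ_pos (j := 0) (k := 2) (by decide)
  have n03 := S.δ_pos (j := 0) (k := 3) (by decide)
  have n12 := S.δ_pos (j := 1) (k := 2) (by decide)
  have n13 := S.δ_pos (j := 1) (k := 3) (by decide)
  have n23 := S.δ_pos (j := 2) (k := 3) (by decide)
  have h3 : (S.h₃ : ℂ) ≠ 0 := Complex.ofReal_ne_zero.2 S.h₃_ne_zero
  have hD : (S.D : ℂ) ≠ 0 := Complex.ofReal_ne_zero.2 S.D_pos.ne'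
  have hΔ : (S.Δ : ℂ) = S.D ^ 2 := by rw [Δ]; push_cast; rfl
  -- the factor that carries the formula for a multiple of `ω` to one for `ω` itself
  have hρ : 0 < 4 / (S.D * S.h₃ ^ 2) :=
    div_pos four_pos (mul_pos S.D_pos (sq_pos_of_ne_zero S.h₃_ne_zero))
  have hω : -S.ω = (Complex.I * (4 / (S.D * S.h₃ ^ 2) : ℝ)) •
      -((S.Δ * (S.h₃ : ℂ) ^ 2 / (4 * Complex.I * S.D)) • S.ω) := by
    have h1 : (Complex.I * (4 / (S.D * S.h₃ ^ 2) : ℝ)) *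
        (S.Δ * (S.h₃ : ℂ) ^ 2 / (4 * Complex.I * S.D)) = 1 := by
      rw [hΔ]
      push_cast
      field_simp [Complex.I_ne_zero]
    rw [smul_neg, smul_smul, h1, one_smul]
  generalize 4 / (S.D * S.h₃ ^ 2) = ρ at hρ hω
  refine isKahlerForm_of_diagonal w
    ![ρ * (S.δ 0 1 ^ 2 * S.δ 0 2 * S.δ 1 2 * S.δ 0 3 ^ 2 * S.δ 2 3),
      ρ * (S.δ 0 1 ^ 2 * S.δ 1 2 ^ 2 * S.δ 0 3 * S.δ 1 3 * S.δ 2 3),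
      ρ * (S.δ 0 1 * S.δ 0 2 * S.δ 1 2 ^ 2 * S.δ 0 3 * S.δ 2 3 ^ 2),
      ρ * (S.δ 0 1 * S.δ 1 2 * S.δ 0 3 ^ 2 * S.δ 1 3 * S.δ 2 3 ^ 2)] (fun j => ?_) ?_
  · fin_cases j <;> simp <;> positivity
  · rw [hω, hw.ω_eq, neg_neg, mul_smul, Fin.sum_univ_four]
    congr 1
    ext m
    simp only [AlternatingMap.smul_apply, AlternatingMap.add_apply, Complex.real_smul, smul_eq_mul,
      Matrix.cons_val]
    push_cast
    ring

theorem IsAdapted.isAbelianVariety (hw : S.IsAdapted S.αStar w) :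
    IsAbelianVariety S.Λ (coordComplexStructure w) := by
  refine hw.isKahlerForm.isAbelianVariety (fun u hu v hv => ?_) (coordComplexStructure_sq w)
    S.exists_lattice_basis
  obtain ⟨q, hq⟩ := S.isRationalClass_ω u hu v hv
  exact ⟨-q, by rw [AlternatingMap.neg_apply, hq, Rat.cast_neg]⟩

end MumfordData

end

theorem mainTheorem6 (S : MumfordData) (c : ℤ) :
    (∃! w : S.V ≃ₗ[ℝ] (Fin 4 → ℂ), S.IsAdapted S.αStar w) ∧
    ∀ w : S.V ≃ₗ[ℝ] (Fin 4 → ℂ), S.IsAdapted S.αStar w →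
      (((S.h₃ : ℂ) ^ 2 / 4) • S.A₁ =
          (S.δ 0 1 ^ 2 * S.δ 1 2 ^ 2 * S.δ 0 3 ^ 2 * S.δ 2 3) • dw w 0 ⋏ dwbar w 1
        - (S.δ 0 1 ^ 2 * S.δ 1 2 ^ 2 * S.δ 0 3 * S.δ 2 3 ^ 2) • dw w 1 ⋏ dwbar w 2
        + (S.δ 0 1 * S.δ 1 2 ^ 2 * S.δ 0 3 ^ 2 * S.δ 2 3 ^ 2) • dw w 2 ⋏ dwbar w 3
        + (S.δ 0 1 ^ 2 * S.δ 1 2 * S.δ 0 3 ^ 2 * S.δ 2 3 ^ 2) • dw w 3 ⋏ dwbar w 0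
        + (S.δ 0 1 ^ 2 * S.δ 1 2 ^ 2 * S.δ 0 3 ^ 2 * S.δ 2 3) • dwbar w 0 ⋏ dw w 1
        - (S.δ 0 1 ^ 2 * S.δ 1 2 ^ 2 * S.δ 0 3 * S.δ 2 3 ^ 2) • dwbar w 1 ⋏ dw w 2
        + (S.δ 0 1 * S.δ 1 2 ^ 2 * S.δ 0 3 ^ 2 * S.δ 2 3 ^ 2) • dwbar w 2 ⋏ dw w 3
        + (S.δ 0 1 ^ 2 * S.δ 1 2 * S.δ 0 3 ^ 2 * S.δ 2 3 ^ 2) • dwbar w 3 ⋏ dw w 0) ∧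
      (((S.h₃ : ℂ) ^ 2 / (4 * Complex.I * S.D)) • S.A₂ c =
        (c : ℂ) •
        ((S.δ 0 1 ^ 2 * S.δ 1 2 ^ 2 * S.δ 0 3 ^ 2 * S.δ 2 3) • dw w 0 ⋏ dwbar w 1
        + (S.δ 0 1 ^ 2 * S.δ 1 2 ^ 2 * S.δ 0 3 * S.δ 2 3 ^ 2) • dw w 1 ⋏ dwbar w 2
        + (S.δ 0 1 * S.δ 1 2 ^ 2 * S.δ 0 3 ^ 2 * S.δ 2 3 ^ 2) • dw w 2 ⋏ dwbar w 3
        - (S.δ 0 1 ^ 2 * S.δ 1 2 * S.δ 0 3 ^ 2 * S.δ 2 3 ^ 2) • dw w 3 ⋏ dwbar w 0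
        - (S.δ 0 1 ^ 2 * S.δ 1 2 ^ 2 * S.δ 0 3 ^ 2 * S.δ 2 3) • dwbar w 0 ⋏ dw w 1
        - (S.δ 0 1 ^ 2 * S.δ 1 2 ^ 2 * S.δ 0 3 * S.δ 2 3 ^ 2) • dwbar w 1 ⋏ dw w 2
        - (S.δ 0 1 * S.δ 1 2 ^ 2 * S.δ 0 3 ^ 2 * S.δ 2 3 ^ 2) • dwbar w 2 ⋏ dw w 3
        + (S.δ 0 1 ^ 2 * S.δ 1 2 * S.δ 0 3 ^ 2 * S.δ 2 3 ^ 2) •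
            dwbar w 3 ⋏ dw w 0)) ∧
      ((S.Δ * (S.h₃ : ℂ) ^ 2 / (4 * Complex.I * S.D)) • S.ω =
        -((S.δ 0 1 ^ 2 * S.δ 0 2 * S.δ 1 2 * S.δ 0 3 ^ 2 * S.δ 2 3) •
            dw w 0 ⋏ dwbar w 0
        + (S.δ 0 1 ^ 2 * S.δ 1 2 ^ 2 * S.δ 0 3 * S.δ 1 3 * S.δ 2 3) •
            dw w 1 ⋏ dwbar w 1
        + (S.δ 0 1 * S.δ 0 2 * S.δ 1 2 ^ 2 * S.δ 0 3 * S.δ 2 3 ^ 2) •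
            dw w 2 ⋏ dwbar w 2
        + (S.δ 0 1 * S.δ 1 2 * S.δ 0 3 ^ 2 * S.δ 1 3 * S.δ 2 3 ^ 2) •
            dw w 3 ⋏ dwbar w 3)) ∧
      (IsRationalClass S.Λ S.A₁ ∧ IsRationalClass S.Λ (S.A₂ c) ∧ IsRationalClass S.Λ S.ω) ∧
      (IsKahlerForm (coordComplexStructure w) (-S.ω) ∧
        IsType11 (coordComplexStructure w) S.A₁ ∧
        IsType11 (coordComplexStructure w) (S.A₂ c) ∧
        IsAbelianVariety S.Λ (coordComplexStructure w)) ∧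
      (IsKahlerForm (-coordComplexStructure w) S.ω ∧
        IsType11 (-coordComplexStructure w) S.A₁ ∧
        IsType11 (-coordComplexStructure w) (S.A₂ c) ∧
        IsAbelianVariety S.Λ (-coordComplexStructure w)) := by
  refine ⟨S.existsUnique_isAdapted, fun w hw => ⟨hw.A₁_eq, hw.A₂_eq c, hw.ω_eq,
    ⟨S.isRationalClass_A₁, S.isRationalClass_A₂ c, S.isRationalClass_ω⟩,
    ⟨hw.isKahlerForm, hw.isType11_A₁, hw.isType11_A₂ c, hw.isAbelianVariety⟩,
    ?_, hw.isType11_A₁.neg_structure, (hw.isType11_A₂ c).neg_structure,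
    hw.isAbelianVariety.neg_structure⟩⟩
  simpa using hw.isKahlerForm.neg_structure
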